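/- Let $\ell\in\{0,\tfrac12,1,\tfrac32,\dots\}$ and index the rows and columns of $(2\ell+1)\times(2\ell+1)$ complex matrices by $0,1,\dots,2\ell$; $E_{i,j}$ is the matrix unit, read as $0$ if an index is out of range, $I$ is the identity matrix, and all sums run over $0\le i\le 2\ell$. Write $(a)_k=a(a+1)\cdots(a+k-1)$. **Orthogonal polynomials.** Let $W(x)$, $x\in[-1,1]$, be the symmetric matrix with entries, for $n\ge m$, $$W(x)_{n,m}=\sqrt{1-x^2}\sum_{t=0}^m\alpha_t(m,n)U_{n+m-2t}(x),\qquad \alpha_t(m,n)=\frac{2\ell+1}{n+1}\,\frac{(2\ell-m)!\,m!}{(2\ell)!}\,(-1)^{m-t}\,\frac{(n-2\ell)_{m-t}}{(n+2)_{m-t}}\,\frac{(2\ell+2-t)_t}{t!},$$ where $U_k$ is the Chebyshev polynomial of the second kind. Let $P_n$ ($n\ge 0$) be the monic matrix-valued orthogonal polynomials for $W$: $P_n$ has degree $n$ and leading coefficient $I$, and $\int_{-1}^1P_n(x)W(x)P_m(x)^*\,dx=\delta_{nm}H_n$ with $H_n$ positive definite. Put $R_n(u)=(-1)^n2^{-n}P_n(1-2u)$.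 **The matrix $M$.** Let $M(u)=L(1-2u)$, where $L(x)_{m,k}=0$ for $k>m$ and $$L(x)_{m,k}=\frac{m!\,(2k+1)!}{(m+k+1)!\,k!}\,C^{(k+1)}_{m-k}(x)\quad(k\le m),\qquad C^{(a)}_n(x)=\frac{(2a)_n}{n!}\sum_{j=0}^n\frac{(-n)_j\,(n+2a)_j}{(a+\frac12)_j\,j!}\Bigl(\frac{1-x}{2}\Bigr)^j$$ (Gegenbauer polynomials). **Differential operators.** These act from the right: $G\bigl(\frac{d^2}{du^2}F_2+\frac{d}{du}F_1+F_0\bigr)=G''F_2+G'F_1+GF_0$ for matrix-valued functions $G$ of $u\in\mathbb R$. Such an operator is called diagonal if $F_2(u),F_1(u),F_0(u)$ are diagonal matrices for all $u$. For $M(u)$ invertible, $\mathcal D'=M^{-1}\mathcal D''M$ means $\bigl((GM^{-1})\mathcal D''\bigr)M=G\mathcal D'$ at every point where $G$ is twice continuously differentiable. Let $$D=u(1-u)\frac{d^2}{du^2}+\frac{d}{du}(C-uU)-V,\qquad E=\frac{d}{du}(uB_1+B_0)+A_0,\qquad D_\alpha=D+\alpha E\quad(\alpha\in\mathbb R),$$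 $$C=-\sum_i\tfrac{2\ell-i}{2}E_{i,i+1}+\sum_i\tfrac{2\ell+3}{2}E_{i,i}-\sum_i\tfrac i2E_{i,i-1},\quad U=(2\ell+3)I,\quad V=-\sum_i i(2\ell-i)E_{i,i},$$ $$B_0=-\sum_i\tfrac{2\ell-i}{4\ell}E_{i,i+1}+\sum_i\tfrac{\ell-i}{2\ell}E_{i,i}+\sum_i\tfrac{i}{4\ell}E_{i,i-1},\quad B_1=-\sum_i\tfrac{\ell-i}{\ell}E_{i,i},\quad A_0=\sum_i\tfrac{(2\ell+2)(i-2\ell)}{2\ell}E_{i,i},$$ and $$\Lambda_n(D)=\sum_i\bigl(-n(n-1)-n(2\ell+3)+i(2\ell-i)\bigr)E_{i,i},\qquad \Lambda_n(E)=\sum_i\Bigl(-\tfrac{n(\ell-i)}{\ell}+\tfrac{(2\ell+2)(i-2\ell)}{2\ell}\Bigr)E_{i,i}.$$ For $\ell=0$ the operator $E$ is not defined; then $D_{-2\ell}$ means $D$ and $\Lambda_n(D)-2\ell\Lambda_n(E)$ means $\Lambda_n(D)$. **Proposition.** 1. $M(u)$ is invertible for every $u$, and $\mathcal D=M^{-1}D_{-2\ell}M$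 is the diagonal differential operator $$\mathcal D=u(1-u)\frac{d^2}{du^2}+\frac{d}{du}T_1(u)+T_0,$$ where $$T_1(u)=\tfrac12T_1^1-u\,T_1^1,\qquad T_1^1=\sum_i(2i+3)E_{i,i},\qquad T_0=\sum_i(2\ell-i)(2\ell+i+2)E_{i,i}.$$ 2. For every $n\ge0$ the function $\mathcal R_n(u)=R_n(u)M(u)$ satisfies $$\mathcal R_n\,\mathcal D=\Lambda_n(\mathcal D)\,\mathcal R_n,\qquad \Lambda_n(\mathcal D)=\Lambda_n(D)-2\ell\,\Lambda_n(E).$$ 3. If $\ell>0$ and $\alpha\in\mathbb R$ is such that $M^{-1}D_\alpha M$ is a diagonal differential operator, then $\alpha=-2\ell$. -/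

import Mathlib

open scoped ComplexOrder
open Finset Matrix

noncomputable section

namespace MVOP

/-- Square matrices of size `2ℓ+1` with rows and columns numbered `0, …, 2ℓ`.
Throughout, `N = 2ℓ` is a natural number, so `ℓ = N / 2`. -/
abbrev Mat (N : ℕ) : Type := Matrix (Fin (N + 1)) (Fin (N + 1)) ℂ

/-- The matrix `∑ i, lo i • E_{i,i-1} + ∑ i, di i • E_{i,i} + ∑ i, up i • E_{i,i+1}`, where
`E_{i,j}` is zero when an index is out of range. -/
def tridiag (N : ℕ) (lo di up : ℕ → ℂ) : Mat N :=
  Matrix.of fun i j =>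
    if (j : ℕ) + 1 = i then lo i
    else if (j : ℕ) = i then di i
    else if (j : ℕ) = i + 1 then up i
    else 0

/-- The matrix `∑ i, di i • E_{i,i}`. -/
def diag (N : ℕ) (di : ℕ → ℂ) : Mat N := Matrix.diagonal fun i => di i

/-! ### The weight and its monic matrix-valued orthogonal polynomials -/

/-- The Pochhammer symbol `(a)_n = a (a+1) ⋯ (a+n-1)`. -/
def poch (a : ℝ) (n : ℕ) : ℝ := ∏ i ∈ range n, (a + i)

/-- The coefficient `α_t(m,n)` of the weight. It is used for `t ≤ m ≤ n ≤ N`, where the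
natural-number subtractions are exact. -/
def weightCoeff (N t m n : ℕ) : ℝ :=
  ((N + 1 : ℝ) / (n + 1)) * (((N - m).factorial * m.factorial : ℝ) / N.factorial) *
    (-1) ^ (m - t) * (poch ((n : ℝ) - N) (m - t) / poch ((n : ℝ) + 2) (m - t)) *
    (poch ((N : ℝ) + 2 - t) t / t.factorial)

/-- The entry of the weight at `(n, m)` for `m ≤ n`; `U` are the Chebyshev polynomials of the
second kind. -/
def weightEntry (N n m : ℕ) (x : ℝ) : ℝ :=
  Real.sqrt (1 - x ^ 2) *
    ∑ t ∈ range (m + 1),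
      weightCoeff N t m n * (Polynomial.Chebyshev.U ℝ ((n + m - 2 * t : ℕ) : ℤ)).eval x

/-- The matrix weight `W(x)`, `x ∈ [-1, 1]`. -/
def weight (N : ℕ) (x : ℝ) : Mat N :=
  Matrix.of fun n m =>
    if (m : ℕ) ≤ n then ((weightEntry N n m x : ℝ) : ℂ) else ((weightEntry N m n x : ℝ) : ℂ)

/-- The value `∑ k, x^k P_k` at a real number of a polynomial with matrix coefficients. -/
def polyVal {N : ℕ} (P : Polynomial (Mat N)) (x : ℝ) : Mat N :=
  ∑ k ∈ range (P.natDegree + 1), ((x : ℂ) ^ k) • P.coeff k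

/-- The matrix-valued inner product `⟨P, Q⟩_W = ∫_{-1}^1 P(x) W(x) Q(x)^* dx`. -/
def matInner {N : ℕ} (P Q : Polynomial (Mat N)) : Mat N :=
  Matrix.of fun i j =>
    ∫ x in (-1 : ℝ)..1, (polyVal P x * weight N x * (polyVal Q x)ᴴ) i j

/-- `P 0, P 1, …` are the monic matrix-valued orthogonal polynomials for the weight `W`. -/
structure IsMonicOrthogonal (N : ℕ) (P : ℕ → Polynomial (Mat N)) : Prop where
  natDegree_eq : ∀ n, (P n).natDegree = n
  monic : ∀ n, (P n).coeff n = 1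
  orthogonal : ∀ n m, n ≠ m → matInner (P n) (P m) = 0
  posDef : ∀ n, (matInner (P n) (P n)).PosDef

/-- The rescaled polynomial `R_n(u) = (-1)^n 2^{-n} P_n(1 - 2u)` as a function of `u`. -/
def rescaled {N : ℕ} (P : ℕ → Polynomial (Mat N)) (n : ℕ) (u : ℝ) : Mat N :=
  (((-1 : ℂ) ^ n) * ((2 : ℂ) ^ n)⁻¹) • polyVal (P n) (1 - 2 * u)

/-! ### The matrix `L` -/

/-- The Gegenbauer polynomial
`C_n^{(a)}(x) = (2a)_n / n! * ₂F₁(-n, n + 2a; a + 1/2; (1 - x)/2)` (a terminating series). -/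
def gegenbauer (a : ℝ) (n : ℕ) (x : ℝ) : ℝ :=
  (poch (2 * a) n / n.factorial) *
    ∑ j ∈ range (n + 1),
      (poch (-(n : ℝ)) j * poch ((n : ℝ) + 2 * a) j) / (poch (a + 1 / 2) j * j.factorial) *
        ((1 - x) / 2) ^ j

/-- The unipotent lower triangular matrix `L(x)`. -/
def lowerL (N : ℕ) (x : ℝ) : Mat N :=
  Matrix.of fun m k =>
    if (k : ℕ) ≤ m then
      ((((m : ℕ).factorial * (2 * (k : ℕ) + 1).factorial : ℝ) /
        (((m : ℕ) + k + 1).factorial * (k : ℕ).factorial) *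
          gegenbauer ((k : ℕ) + 1) ((m : ℕ) - k) x : ℝ) : ℂ)
    else 0

/-- `M(u) = L(1 - 2u)`. -/
def matM (N : ℕ) (u : ℝ) : Mat N := lowerL N (1 - 2 * u)

/-! ### Matrix-valued differential operators acting from the right -/

/-- The operator `(d²/du²) F₂(u) + (d/du) F₁(u) + F₀(u)`. -/
@[ext] structure DiffOp (N : ℕ) where
  F2 : ℝ → Mat N
  F1 : ℝ → Mat N
  F0 : ℝ → Mat N

/-- The entrywise derivative. -/
def matDeriv {N : ℕ} (G : ℝ → Mat N) (u : ℝ) : Mat N :=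
  Matrix.of fun i j => deriv (fun v => G v i j) u

/-- All entries are twice continuously differentiable at `u`. -/
def C2At {N : ℕ} (G : ℝ → Mat N) (u : ℝ) : Prop :=
  ∀ i j, ContDiffAt ℝ 2 (fun v => G v i j) u

namespace DiffOp

variable {N : ℕ}

/-- The right action `G D = G'' F₂ + G' F₁ + G F₀`. -/
def act (D : DiffOp N) (G : ℝ → Mat N) (u : ℝ) : Mat N :=
  matDeriv (matDeriv G) u * D.F2 u + matDeriv G u * D.F1 u + G u * D.F0 u

instance : Add (DiffOp N) where
  add D E := ⟨fun u => D.F2 u + E.F2 u, fun u => D.F1 u + E.F1 u, fun u => D.F0 u + E.F0 u⟩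

instance : SMul ℝ (DiffOp N) where
  smul a D := ⟨fun u => (a : ℂ) • D.F2 u, fun u => (a : ℂ) • D.F1 u, fun u => (a : ℂ) • D.F0 u⟩

/-- A diagonal differential operator: all coefficients are diagonal matrices. -/
def IsDiagonal (D : DiffOp N) : Prop :=
  ∀ u, (D.F2 u).IsDiag ∧ (D.F1 u).IsDiag ∧ (D.F0 u).IsDiag

/-- `D' = M⁻¹ D M`. As operators act from the right, this says that
`((G M⁻¹) D) M = G D'` for every function `G` (at every point where `G` is `C²`). -/
def IsConjugate (M : ℝ → Mat N) (D D' : DiffOp N) : Prop :=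
  ∀ (u : ℝ) (G : ℝ → Mat N), C2At G u →
    D.act (fun v => G v * (M v)⁻¹) u * M u = D'.act G u

end DiffOp

/-! ### The operators `D`, `E`, `D_α` and the explicit diagonal operator -/

def matC (N : ℕ) : Mat N :=
  tridiag N (fun i => -((i : ℂ) / 2)) (fun _ => ((N : ℂ) + 3) / 2) (fun i => -(((N : ℂ) - i) / 2))

def matU (N : ℕ) : Mat N := ((N : ℂ) + 3) • (1 : Mat N)

def matV (N : ℕ) : Mat N := diag N fun i => -((i : ℂ) * ((N : ℂ) - i))

/-- `A₀ = ∑ i, (2ℓ+2)(i-2ℓ)/(2ℓ) E_{i,i}`. -/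
def matA0 (N : ℕ) : Mat N := diag N fun i => ((N : ℂ) + 2) * ((i : ℂ) - N) / N

/-- `B₁ = -∑ i, (ℓ-i)/ℓ E_{i,i}`. -/
def matB1 (N : ℕ) : Mat N := diag N fun i => -(((N : ℂ) / 2 - i) / ((N : ℂ) / 2))

/-- `B₀ = ∑ i, (-(2ℓ-i)/(4ℓ) E_{i,i+1} + (ℓ-i)/(2ℓ) E_{i,i} + i/(4ℓ) E_{i,i-1})`. -/
def matB0 (N : ℕ) : Mat N :=
  tridiag N (fun i => (i : ℂ) / (2 * N)) (fun i => ((N : ℂ) / 2 - i) / N)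
    (fun i => -(((N : ℂ) - i) / (2 * N)))

/-- `D = u(1-u) d²/du² + (d/du)(C - uU) - V`. -/
def opD (N : ℕ) : DiffOp N where
  F2 u := ((u : ℂ) * (1 - u)) • (1 : Mat N)
  F1 u := matC N - (u : ℂ) • matU N
  F0 _ := -matV N

/-- `E = (d/du)(u B₁ + B₀) + A₀`. It is meaningful for `N = 2ℓ ≥ 1` only. -/
def opE (N : ℕ) : DiffOp N where
  F2 _ := 0
  F1 u := (u : ℂ) • matB1 N + matB0 N
  F0 _ := matA0 N

/-- `D_α = D + α E`. -/
def opDα (N : ℕ) (α : ℝ) : DiffOp N := opD N + α • opE N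

/-- `Λ_n(D)`. -/
def eigD (N n : ℕ) : Mat N :=
  diag N fun i => -((n : ℂ) * ((n : ℂ) - 1)) - n * ((N : ℂ) + 3) + i * ((N : ℂ) - i)

/-- `Λ_n(E) = ∑ i, (-n(ℓ-i)/ℓ + (2ℓ+2)(i-2ℓ)/(2ℓ)) E_{i,i}`. -/
def eigE (N n : ℕ) : Mat N :=
  diag N fun i =>
    -((n : ℂ) * ((N : ℂ) / 2 - i) / ((N : ℂ) / 2)) + ((N : ℂ) + 2) * ((i : ℂ) - N) / N

/-- `T₁¹ = ∑ i, (2i+3) E_{i,i}`. -/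
def matT11 (N : ℕ) : Mat N := diag N fun i => 2 * (i : ℂ) + 3

/-- `T₁(u) = T₁¹/2 - u T₁¹`. -/
def matT1 (N : ℕ) (u : ℝ) : Mat N := (1 / 2 : ℂ) • matT11 N - (u : ℂ) • matT11 N

/-- `T₀ = ∑ i, (2ℓ-i)(2ℓ+i+2) E_{i,i}`. -/
def matT0 (N : ℕ) : Mat N := diag N fun i => ((N : ℂ) - i) * ((N : ℂ) + i + 2)

/-- The diagonal operator `u(1-u) d²/du² + (d/du) T₁(u) + T₀`. -/
def opDiag (N : ℕ) : DiffOp N where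
  F2 u := ((u : ℂ) * (1 - u)) • (1 : Mat N)
  F1 u := matT1 N u
  F0 _ := matT0 N

end MVOP

end

open MVOP

/-! At `α = -2ℓ` the superdiagonals of `C` and `α B₀` cancel. The operator `D_{-2ℓ}` has first-order
coefficient `F₁ = (1/2 - u) T₁¹ - S` with `S = ∑ i E_{i,i-1}`, and zeroth-order coefficient `T₀`.
Writing `G = F M` and comparing the coefficients of `F'` and `F`, conjugation amounts to `F₁ M =
2u(1-u) M' + M T₁` and `T₀ M = u(1-u) M'' + M' T₁ + M T₀`. Entrywise, the second is the Gegenbauer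
differential equation (`matMPoly_ode`) and the first is the rule expressing `(1-x²) (d/dx) C_n`
through `C_n` and `C_{n-1}` (`matMPoly_derivative`).

The eigenvalue equation comes from symmetry. In `x = 1 - 2u` the operator is `P ↦ (1-x²) P'' + P' F₁
+ P T₀`, where now `F₁ = 2S - x T₁¹`. It does not raise degrees, and it sends the leading term `x^n
I` to `Λ_n x^n`. It is symmetric for `W` (`matInner_xAct`) because `F₁ W = K + ((1-x²) W)'` with `K`
antisymmetric, `K' = T₀ W - W T₀` and `K(±1) = 0`. With `x = cos θ` the entries of `W` are sine
sums, and these relations reduce to contiguity of the `α_t(m,n)` (`weightCoeff_contiguous`).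
Applying the operator to `P_n` and subtracting `Λ_n P_n` leaves a polynomial of degree less than `n`
orthogonal to every `P_m` with `m < n`, hence zero (`xAct_eq`).

Uniqueness of `α` holds because `M` is unipotent lower triangular: a diagonal conjugate forces the
`(0,1)` entry of the first-order coefficient at `u = 0`, namely `-(2ℓ + α)/2`, to vanish. -/

namespace MVOP

/-! ### Gegenbauer polynomials: coefficients, differential equation, derivative rule. -/

open Polynomial in
theorem coeff_X_mul_derivative (p : ℝ[X]) (j : ℕ) :
    (X * derivative p).coeff j = j * p.coeff j := by
  cases j with
  | zero => simp
  | succ j => rw [coeff_X_mul, coeff_derivative]; push_cast; ring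

open Polynomial in
theorem coeff_X_mul_derivative_derivative (p : ℝ[X]) (j : ℕ) :
    (X * derivative (derivative p)).coeff j = (j + 1) * j * p.coeff (j + 1) := by
  rw [coeff_X_mul_derivative, coeff_derivative]; ring

open Polynomial in
theorem coeff_X_mul_X_mul_derivative_derivative (p : ℝ[X]) (j : ℕ) :
    (X * (X * derivative (derivative p))).coeff j = j * (j - 1) * p.coeff j := by
  cases j with
  | zero => simp
  | succ j => rw [coeff_X_mul, coeff_X_mul_derivative_derivative]; push_cast; ring

theorem poch_zero (a : ℝ) : poch a 0 = 1 := by simp [poch]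

theorem poch_succ (a : ℝ) (n : ℕ) : poch a (n + 1) = poch a n * (a + n) := by
  simp [poch, prod_range_succ]

theorem poch_succ_left (a : ℝ) (n : ℕ) : poch a (n + 1) = a * poch (a + 1) n := by
  simp only [poch, prod_range_succ']
  rw [mul_comm]
  congr 1
  · simp
  · exact prod_congr rfl fun i _ => by push_cast; ring

theorem poch_pos {a : ℝ} (ha : 0 < a) (n : ℕ) : 0 < poch a n :=
  prod_pos fun _ _ => by positivity

theorem poch_neg_natCast_eq_zero {n j : ℕ} (h : n < j) : poch (-(n : ℝ)) j = 0 :=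
  prod_eq_zero (mem_range.2 h) (by ring)

/-- The coefficients of the Gegenbauer polynomial as a hypergeometric series. -/
noncomputable def gegCoeff (a : ℝ) (n j : ℕ) : ℝ :=
  (poch (2 * a) n / n.factorial) *
    ((poch (-(n : ℝ)) j * poch ((n : ℝ) + 2 * a) j) / (poch (a + 1 / 2) j * j.factorial))

theorem gegCoeff_eq_zero {a : ℝ} {n j : ℕ} (h : n < j) : gegCoeff a n j = 0 := by
  simp [gegCoeff, poch_neg_natCast_eq_zero h]

/-- The term ratio of the hypergeometric series; it is the differential equation read off
coefficient by coefficient. -/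
theorem gegCoeff_succ {a : ℝ} (ha : 0 < a) (n j : ℕ) :
    (j + 1) * (j + a + 1 / 2) * gegCoeff a n (j + 1) =
      (j - n) * (j + n + 2 * a) * gegCoeff a n j := by
  have h1 : poch (a + 1 / 2) j ≠ 0 := (poch_pos (by positivity) j).ne'
  have h2 : a + 1 / 2 + j ≠ 0 := by positivity
  have h3 : (j.factorial : ℝ) ≠ 0 := by positivity
  have h4 : (n.factorial : ℝ) ≠ 0 := by positivity
  have h5 : (j + 1 : ℝ) ≠ 0 := by positivity
  simp only [gegCoeff, poch_succ, Nat.factorial_succ]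
  push_cast
  generalize poch (a + 1 / 2) j = p at *
  rw [show (j : ℝ) + a + 1 / 2 = a + 1 / 2 + j by ring]
  generalize a + 1 / 2 + (j : ℝ) = q at *
  field_simp
  ring

/-- The ratio in the degree, with a common factor `n + 2a` left on both sides. It follows from
peeling off the first or the last factor of `(-(n+1))_{j+1}` and of `(n+2a)_{j+1}`. -/
theorem gegCoeff_pred {a : ℝ} (ha : 0 < a) (n j : ℕ) :
    (n + 1 + 2 * a - 1 + j) * ((n + 1 + 2 * a - 1) * gegCoeff a n j) =
      (n + 1 - j) * (n + 1 + 2 * a - 1) * gegCoeff a (n + 1) j := by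
  have h1 : poch (a + 1 / 2) j ≠ 0 := (poch_pos (by positivity) j).ne'
  have h3 : (j.factorial : ℝ) ≠ 0 := by positivity
  have h4 : (n.factorial : ℝ) ≠ 0 := by positivity
  have h5 : (n + 1 : ℝ) ≠ 0 := by positivity
  have e1 : (-(n + 1 : ℝ)) * poch (-(n : ℝ)) j = poch (-(n + 1 : ℝ)) j * (-(n + 1 : ℝ) + j) := by
    rw [← poch_succ, poch_succ_left]; congr 2; ring
  have e2 : (n + 2 * a) * poch (n + 1 + 2 * a) j = poch (n + 2 * a) j * (n + 2 * a + j) := by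
    rw [← poch_succ, poch_succ_left]; congr 2; ring
  simp only [gegCoeff, poch_succ, Nat.factorial_succ]
  push_cast
  generalize poch (a + 1 / 2) j = p at *
  field_simp
  linear_combination (-(n + 2 * a) * poch (2 * a) n) *
    ((n + 1 - j : ℝ) * poch (-(n + 1 : ℝ)) j * e2 + (n + 2 * a + j) * poch (n + 2 * a) j * e1)

/-- This is the coefficient of `X^(j+1)` in `gegPoly_derivative`. -/
theorem gegCoeff_rel {a : ℝ} (ha : 0 < a) (n j : ℕ) :
    2 * (j + 1) * gegCoeff a (n + 1) (j + 1) - 2 * j * gegCoeff a (n + 1) j =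
      (n + 1) * gegCoeff a (n + 1) (j + 1) - 2 * (n + 1) * gegCoeff a (n + 1) j -
        (n + 1 + 2 * a - 1) * gegCoeff a n (j + 1) := by
  have h1 := gegCoeff_succ ha (n + 1) j
  have h2 := gegCoeff_pred ha n (j + 1)
  have h3 : (n + 1 + 2 * a + j : ℝ) ≠ 0 := by positivity
  push_cast at h1 h2
  apply mul_left_cancel₀ h3
  linear_combination 2 * h1 + h2

open Polynomial

/-- The Gegenbauer polynomial in the variable `(1 - x) / 2`. -/
noncomputable def gegPoly (a : ℝ) (n : ℕ) : ℝ[X] := ∑ j ∈ range (n + 1), C (gegCoeff a n j) * X ^ j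

theorem coeff_gegPoly (a : ℝ) (n j : ℕ) : (gegPoly a n).coeff j = gegCoeff a n j := by
  simp only [gegPoly, finsetSum_coeff, coeff_C_mul, coeff_X_pow, mul_ite, mul_one, mul_zero]
  rw [sum_ite_eq]
  split_ifs with h
  · rfl
  · rw [gegCoeff_eq_zero (by simpa using h)]

theorem eval_gegPoly (a : ℝ) (n : ℕ) (u : ℝ) : (gegPoly a n).eval u = gegenbauer a n (1 - 2 * u) := by
  simp only [gegPoly, gegenbauer, eval_finsetSum, mul_sum]
  refine sum_congr rfl fun j _ => ?_
  simp only [gegCoeff, eval_mul, eval_C, eval_pow, eval_X]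
  rw [show (1 - (1 - 2 * u)) / 2 = u by ring]
  ring

theorem gegPoly_ode {a : ℝ} (ha : 0 < a) (n : ℕ) :
    X * (1 - X) * derivative (derivative (gegPoly a n)) +
      (C (2 * a + 1) * (C (1 / 2) - X)) * derivative (gegPoly a n) +
        C ((n : ℝ) * (n + 2 * a)) * gegPoly a n = 0 := by
  have e : X * (1 - X) * derivative (derivative (gegPoly a n)) +
      (C (2 * a + 1) * (C (1 / 2) - X)) * derivative (gegPoly a n) +
        C ((n : ℝ) * (n + 2 * a)) * gegPoly a n =
      X * derivative (derivative (gegPoly a n)) - X * (X * derivative (derivative (gegPoly a n))) +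
      C ((2 * a + 1) * (1 / 2)) * derivative (gegPoly a n)
        - C (2 * a + 1) * (X * derivative (gegPoly a n)) +
        C ((n : ℝ) * (n + 2 * a)) * gegPoly a n := by
    rw [C_mul (a := 2 * a + 1)]; ring
  rw [e]
  ext j
  simp only [coeff_add, coeff_sub, coeff_C_mul, coeff_X_mul_derivative,
    coeff_X_mul_X_mul_derivative_derivative, coeff_derivative,
    coeff_gegPoly, coeff_zero]
  linear_combination gegCoeff_succ ha n j

theorem gegPoly_derivative {a : ℝ} (ha : 0 < a) (n : ℕ) :
    2 * X * (1 - X) * derivative (gegPoly a (n + 1)) =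
      C ((n : ℝ) + 1) * (1 - 2 * X) * gegPoly a (n + 1) -
        C ((n : ℝ) + 1 + 2 * a - 1) * gegPoly a n := by
  have e1 : 2 * X * (1 - X) * derivative (gegPoly a (n + 1)) =
      C 2 * (X * derivative (gegPoly a (n + 1))) -
        X * (C 2 * (X * derivative (gegPoly a (n + 1)))) := by
    rw [show (C 2 : ℝ[X]) = 2 from rfl]; ring
  have e2 : C ((n : ℝ) + 1) * (1 - 2 * X) * gegPoly a (n + 1) =
      C ((n : ℝ) + 1) * gegPoly a (n + 1) -
        X * (C (2 * ((n : ℝ) + 1)) * gegPoly a (n + 1)) := by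
    rw [C_mul (a := 2), show (C 2 : ℝ[X]) = 2 from rfl]; ring
  rw [e1, e2]
  ext j
  cases j with
  | zero =>
    have h := gegCoeff_pred ha n 0
    have h3 : (n + 2 * a : ℝ) ≠ 0 := by positivity
    simp only [coeff_sub, mul_coeff_zero, coeff_X_zero, coeff_gegPoly, coeff_C_zero]
    push_cast at h ⊢
    apply mul_left_cancel₀ h3
    linear_combination h
  | succ j =>
    simp only [coeff_sub, coeff_C_mul, coeff_X_mul, coeff_X_mul_derivative, coeff_gegPoly]
    rw [coeff_derivative, coeff_gegPoly]
    linear_combination gegCoeff_rel ha n j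

/-! ### The entries of `M` as polynomials. -/

/-- The normalizing factor of the entries of `L`. -/
noncomputable def lowerLFactor (m k : ℕ) : ℝ :=
  (m.factorial * (2 * k + 1).factorial : ℝ) / ((m + k + 1).factorial * k.factorial)

/-- The entries of `M` as polynomials in `u`. -/
noncomputable def matMPoly (m k : ℕ) : ℝ[X] :=
  if k ≤ m then C (lowerLFactor m k) * gegPoly (k + 1) (m - k) else 0

theorem matM_apply (N : ℕ) (u : ℝ) (m k : Fin (N + 1)) :
    matM N u m k = (((matMPoly m k).eval u : ℝ) : ℂ) := by
  simp only [matM, lowerL, matMPoly, of_apply]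
  split_ifs
  · rw [eval_mul, eval_C, eval_gegPoly, lowerLFactor]
  · simp

theorem matMPoly_self (k : ℕ) : matMPoly k k = 1 := by
  have h : lowerLFactor k k = 1 := by
    rw [lowerLFactor, show k + k + 1 = 2 * k + 1 by ring]
    have := Nat.factorial_pos k
    have := Nat.factorial_pos (2 * k + 1)
    field_simp
  simp [matMPoly, h, gegPoly, gegCoeff, poch_zero]

theorem matMPoly_of_lt {m k : ℕ} (h : m < k) : matMPoly m k = 0 := by
  simp [matMPoly, h.not_ge]

theorem matMPoly_ode (m k : ℕ) :
    X * (1 - X) * derivative (derivative (matMPoly m k)) +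
      (C (2 * (k : ℝ) + 3) * (C (1 / 2) - X)) * derivative (matMPoly m k) +
        C (((m : ℝ) - k) * (m + k + 2)) * matMPoly m k = 0 := by
  by_cases h : k ≤ m
  · obtain ⟨n, rfl⟩ := Nat.exists_eq_add_of_le h
    have := gegPoly_ode (a := (k : ℝ) + 1) (by positivity) n
    simp only [matMPoly, h, if_true, Nat.add_sub_cancel_left, derivative_C_mul]
    rw [show 2 * ((k : ℝ) + 1) + 1 = 2 * k + 3 by ring] at this
    rw [show (((k + n : ℕ) : ℝ) - k) * (((k + n : ℕ) : ℝ) + k + 2) =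
      (n : ℝ) * (n + 2 * ((k : ℝ) + 1)) by push_cast; ring]
    linear_combination C (lowerLFactor (k + n) k) * this
  · simp [matMPoly, h]

/-- The normalization of `L` turns the factor `n + 2a - 1` of the Gegenbauer rule (`n = m - k`, `a =
k + 1`) into `m`, independent of `k`, so the relation is left multiplication by a shift matrix. At
`m = 0` the truncated `m - 1` is harmless, being multiplied by `m`. -/
theorem matMPoly_derivative (m k : ℕ) :
    2 * X * (1 - X) * derivative (matMPoly m k) =
      C ((m : ℝ) - k) * (1 - 2 * X) * matMPoly m k - C (m : ℝ) * matMPoly (m - 1) k := by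
  rcases lt_trichotomy m k with h | rfl | h
  · rw [matMPoly_of_lt h, matMPoly_of_lt (by omega)]; simp
  · rw [matMPoly_self]
    cases m with
    | zero => simp
    | succ m => rw [matMPoly_of_lt (by omega)]; simp
  · obtain ⟨n, rfl⟩ := Nat.exists_eq_add_of_lt h
    have := gegPoly_derivative (a := (k : ℝ) + 1) (by positivity) n
    have e : lowerLFactor (k + n + 1) k * ((n : ℝ) + 1 + 2 * (k + 1) - 1) =
        ((k + n + 1 : ℕ) : ℝ) * lowerLFactor (k + n) k := by
      simp only [lowerLFactor]
      rw [show k + n + 1 + k + 1 = (k + n + k + 1) + 1 by ring, Nat.factorial_succ (k + n),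
        Nat.factorial_succ (k + n + k + 1)]
      have := Nat.factorial_pos (k + n + k + 1)
      have := Nat.factorial_pos k
      push_cast
      field_simp
      ring
    have e' := congrArg (C : ℝ → ℝ[X]) e
    rw [C_mul, C_mul] at e'
    simp only [matMPoly, Nat.add_sub_cancel, h.le, if_true, derivative_C_mul,
      show k ≤ k + n by omega, show k + n + 1 - k = n + 1 by omega, Nat.add_sub_cancel_left]
    rw [show (((k + n + 1 : ℕ) : ℝ) - k) = (n : ℝ) + 1 by push_cast; ring]
    linear_combination C (lowerLFactor (k + n + 1) k) * this - gegPoly (k + 1) n * e'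

end MVOP

/-! ### Calculus of matrix-valued functions and invertibility of `M`. -/

namespace MVOP

open Filter Topology

variable {N : ℕ}

/-- Entrywise differentiability with a given derivative. -/
def HasMatDerivAt (G : ℝ → Mat N) (G' : Mat N) (u : ℝ) : Prop :=
  ∀ i j, HasDerivAt (fun v => G v i j) (G' i j) u

namespace HasMatDerivAt

variable {F G : ℝ → Mat N} {F' G' : Mat N} {u : ℝ}

theorem matDeriv_eq (h : HasMatDerivAt G G' u) : matDeriv G u = G' := by
  ext i j; exact (h i j).deriv

theorem add (hF : HasMatDerivAt F F' u) (hG : HasMatDerivAt G G' u) :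
    HasMatDerivAt (fun v => F v + G v) (F' + G') u := fun i j => (hF i j).add (hG i j)

theorem sub (hF : HasMatDerivAt F F' u) (hG : HasMatDerivAt G G' u) :
    HasMatDerivAt (fun v => F v - G v) (F' - G') u := fun i j => (hF i j).sub (hG i j)

theorem mul (hF : HasMatDerivAt F F' u) (hG : HasMatDerivAt G G' u) :
    HasMatDerivAt (fun v => F v * G v) (F' * G u + F u * G') u := by
  intro i j
  simp only [mul_apply, Matrix.add_apply, ← sum_add_distrib]
  exact HasDerivAt.fun_sum fun k _ => (hF i k).mul (hG k j)

theorem smul {f : ℝ → ℂ} {f' : ℂ} (hf : HasDerivAt f f' u) (hG : HasMatDerivAt G G' u) :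
    HasMatDerivAt (fun v => f v • G v) (f' • G u + f u • G') u :=
  fun i j => hf.mul (hG i j)

theorem const_smul (c : ℂ) (hG : HasMatDerivAt G G' u) :
    HasMatDerivAt (fun v => c • G v) (c • G') u := fun i j => (hG i j).const_mul c

theorem conjTranspose (hG : HasMatDerivAt G G' u) : HasMatDerivAt (fun v => (G v)ᴴ) G'ᴴ u :=
  fun i j => (hG j i).star

theorem congr_deriv {G'' : Mat N} (hG : HasMatDerivAt G G' u) (h : G' = G'') :
    HasMatDerivAt G G'' u := h ▸ hG

theorem congr_of_eventuallyEq (hG : HasMatDerivAt G G' u) (h : F =ᶠ[𝓝 u] G) :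
    HasMatDerivAt F G' u :=
  fun i j => (hG i j).congr_of_eventuallyEq (h.mono fun _ hv => congrFun (congrFun hv i) j)

end HasMatDerivAt

namespace C2At

variable {F G : ℝ → Mat N} {u : ℝ}

theorem hasMatDerivAt (h : C2At F u) : HasMatDerivAt F (matDeriv F u) u :=
  fun i j => ((h i j).differentiableAt (by norm_num)).hasDerivAt

theorem eventually (h : C2At F u) : ∀ᶠ v in 𝓝 u, C2At F v :=
  eventually_all.2 fun i => eventually_all.2 fun j => (h i j).eventually (by simp)

theorem hasMatDerivAt_matDeriv (h : C2At F u) :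
    HasMatDerivAt (matDeriv F) (matDeriv (matDeriv F) u) u := by
  intro i j
  have h1 : ContDiffAt ℝ 1 (fun v => fderiv ℝ (fun w => F w i j) v) u :=
    (h i j).fderiv_right (by norm_num)
  have h2 : DifferentiableAt ℝ (fun v => matDeriv F v i j) u := by
    have := (h1.differentiableAt (by norm_num)).clm_apply (differentiableAt_const (1 : ℝ))
    exact this
  exact h2.hasDerivAt

theorem mul (hF : C2At F u) (hG : C2At G u) : C2At (fun v => F v * G v) u := by
  intro i j
  simp only [mul_apply]
  exact ContDiffAt.sum fun k _ => (hF i k).mul (hG k j)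

end C2At

theorem DiffOp.act_of_hasMatDerivAt (D : DiffOp N) {G dG : ℝ → Mat N} {ddG : Mat N} {u : ℝ}
    (h1 : ∀ᶠ v in 𝓝 u, HasMatDerivAt G (dG v) v) (h2 : HasMatDerivAt dG ddG u) :
    D.act G u = ddG * D.F2 u + dG u * D.F1 u + G u * D.F0 u := by
  have e : matDeriv G =ᶠ[𝓝 u] dG := h1.mono fun v hv => hv.matDeriv_eq
  rw [DiffOp.act, e.eq_of_nhds, (h2.congr_of_eventuallyEq e).matDeriv_eq]

theorem DiffOp.act_mul (D : DiffOp N) {F M dM : ℝ → Mat N} {ddM : Mat N} {u : ℝ}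
    (hF : C2At F u) (h1 : ∀ v, HasMatDerivAt M (dM v) v) (h2 : HasMatDerivAt dM ddM u) :
    D.act (fun v => F v * M v) u =
      (matDeriv (matDeriv F) u * M u + (2 : ℂ) • (matDeriv F u * dM u) + F u * ddM) * D.F2 u +
        (matDeriv F u * M u + F u * dM u) * D.F1 u + F u * M u * D.F0 u := by
  rw [D.act_of_hasMatDerivAt (hF.eventually.mono fun v hv => hv.hasMatDerivAt.mul (h1 v))
    ((hF.hasMatDerivAt_matDeriv.mul (h1 u)).add (hF.hasMatDerivAt.mul h2)), two_smul]
  congr 3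
  abel

/-- The derivative of `M`. -/
noncomputable def dmatM (N : ℕ) (u : ℝ) : Mat N :=
  of fun m k => (((Polynomial.derivative (matMPoly m k)).eval u : ℝ) : ℂ)

/-- The second derivative of `M`. -/
noncomputable def ddmatM (N : ℕ) (u : ℝ) : Mat N :=
  of fun m k =>
    (((Polynomial.derivative (Polynomial.derivative (matMPoly m k))).eval u : ℝ) : ℂ)

theorem hasMatDerivAt_matM (u : ℝ) : HasMatDerivAt (matM N) (dmatM N u) u := by
  intro i j
  simp only [matM_apply]
  exact ((matMPoly i j).hasDerivAt u).ofReal_comp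

theorem hasMatDerivAt_dmatM (u : ℝ) : HasMatDerivAt (dmatM N) (ddmatM N u) u :=
  fun i j => ((Polynomial.derivative (matMPoly i j)).hasDerivAt u).ofReal_comp

theorem det_matM (u : ℝ) : (matM N u).det = 1 := by
  rw [det_of_isLowerTriangular _ fun i j hij => ?_]
  · exact prod_eq_one fun i _ => by simp [matM_apply, matMPoly_self]
  · rw [matM_apply, matMPoly_of_lt (by simpa using hij)]; simp

theorem isUnit_matM (u : ℝ) : IsUnit (matM N u) := by
  rw [isUnit_iff_isUnit_det, det_matM]; exact isUnit_one

theorem matM_inv_mul (u : ℝ) : (matM N u)⁻¹ * matM N u = 1 :=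
  nonsing_inv_mul _ (by simp [det_matM])

theorem matM_mul_inv (u : ℝ) : matM N u * (matM N u)⁻¹ = 1 :=
  mul_nonsing_inv _ (by simp [det_matM])

theorem contDiff_matM (i j : Fin (N + 1)) : ContDiff ℝ 2 fun v => matM N v i j := by
  simp only [matM_apply]
  exact Complex.ofRealCLM.contDiff.comp ((matMPoly i j).contDiff_aeval (𝕜 := ℝ) 2)

theorem c2At_matM (u : ℝ) : C2At (matM N) u := fun i j => (contDiff_matM i j).contDiffAt

/-- Since `det M = 1`, the inverse is the adjugate, whose entries are polynomials in those of `M`.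
-/
theorem c2At_matM_inv (u : ℝ) : C2At (fun v => (matM N v)⁻¹) u := by
  intro i j
  have e : ∀ v, (matM N v)⁻¹ i j = ((matM N v).updateRow j (Pi.single i 1)).det := fun v => by
    rw [Matrix.inv_def, det_matM, Ring.inverse_one, one_smul, adjugate_apply]
  simp only [e, det_apply]
  refine ContDiffAt.sum fun σ _ => ContDiffAt.const_smul _ (contDiffAt_prod fun k _ => ?_)
  simp only [updateRow_apply]
  split_ifs
  · exact contDiffAt_const
  · exact (contDiff_matM _ _).contDiffAt

/-! ### Conjugation of `D_{-2ℓ}` by `M`, and uniqueness of `α`. -/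

/-- The matrix `∑ i, i • E_{i,i-1}`. -/
def lowerShift (N : ℕ) : Mat N := of fun i j => if (j : ℕ) + 1 = i then (i : ℂ) else 0

theorem lowerShift_mul_apply (A : Mat N) (a : ℕ → ℂ) (j : Fin (N + 1)) (hA : ∀ k, A k j = a k)
    (i : Fin (N + 1)) : (lowerShift N * A) i j = i * a (i - 1) := by
  simp only [mul_apply, lowerShift, of_apply, ite_mul, zero_mul]
  obtain ⟨i, hi⟩ := i
  cases i with
  | zero => simp
  | succ i =>
    rw [sum_eq_single ⟨i, by omega⟩]
    · simp [hA]
    · intro b _ hb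
      rw [if_neg]
      intro h
      exact hb (Fin.ext (by simpa using h))
    · simp

theorem opDα_neg_F1 (u : ℝ) :
    (opDα N (-(N : ℝ))).F1 u = (1 / 2 - u : ℂ) • matT11 N - lowerShift N := by
  change (matC N - (u : ℂ) • matU N) + ((-(N : ℝ) : ℝ) : ℂ) • ((u : ℂ) • matB1 N + matB0 N) = _
  ext i j
  -- At `N = 0` the scalar `-N` is zero, so the meaningless quotients in `E` drop out, in accordance
  -- with the convention `D_{-2ℓ} = D`.
  have hN : (N : ℂ) = 0 → (i : ℕ) = j ∧ (i : ℕ) = 0 := fun h => by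
    have : N = 0 := by exact_mod_cast h
    omega
  simp only [matC, matU, matB1, matB0, matT11, diag, tridiag, lowerShift, Matrix.add_apply,
    Matrix.sub_apply, Matrix.smul_apply, of_apply, diagonal_apply, one_apply, smul_eq_mul,
    Fin.ext_iff]
  push_cast
  by_cases h0 : (N : ℂ) = 0
  · obtain ⟨h1, h2⟩ := hN h0
    have h3 : (j : ℕ) = 0 := by omega
    simp [h2, h3, h0]
    ring
  · split_ifs <;> first | omega | (field_simp; ring)

theorem opDα_neg_F0 (u : ℝ) : (opDα N (-(N : ℝ))).F0 u = matT0 N := by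
  change -matV N + ((-(N : ℝ) : ℝ) : ℂ) • matA0 N = _
  ext i j
  have hN : (N : ℂ) = 0 → (i : ℕ) = 0 := fun h => by
    have : N = 0 := by exact_mod_cast h
    omega
  simp only [matV, matA0, matT0, diag, Matrix.add_apply, Matrix.neg_apply, Matrix.smul_apply,
    diagonal_apply, smul_eq_mul]
  push_cast
  by_cases h0 : (N : ℂ) = 0
  · simp [hN h0, h0]
  · split_ifs <;> field_simp <;> ring

theorem opDα_F2 (α u : ℝ) : (opDα N α).F2 u = ((u : ℂ) * (1 - u)) • (1 : Mat N) := by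
  change ((u : ℂ) * (1 - u)) • (1 : Mat N) + (α : ℂ) • (0 : Mat N) = _
  simp

theorem matT1_eq (u : ℝ) : matT1 N u = (1 / 2 - u : ℂ) • matT11 N := by
  rw [matT1, sub_smul]

theorem opDα_neg_F1_mul_matM (u : ℝ) :
    (opDα N (-(N : ℝ))).F1 u * matM N u =
      (2 * ((u : ℂ) * (1 - u))) • dmatM N u + matM N u * matT1 N u := by
  rw [opDα_neg_F1, matT1_eq]
  ext i j
  have h := congrArg (fun p : Polynomial ℝ => ((p.eval u : ℝ) : ℂ)) (matMPoly_derivative i j)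
  simp only [Polynomial.eval_mul, Polynomial.eval_sub, Polynomial.eval_C, Polynomial.eval_X,
    Polynomial.eval_ofNat, Polynomial.eval_one] at h
  push_cast at h
  rw [sub_mul, Matrix.sub_apply, lowerShift_mul_apply _ (fun k => (((matMPoly k j).eval u : ℝ) : ℂ)) j
    (fun k => matM_apply N u k j), smul_mul_assoc, mul_smul_comm]
  simp only [matT11, diag, Matrix.smul_apply, diagonal_mul, mul_diagonal, smul_eq_mul, matM_apply,
    Matrix.add_apply, dmatM, of_apply]
  linear_combination -h

theorem opDα_neg_F0_mul_matM (u : ℝ) :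
    (opDα N (-(N : ℝ))).F0 u * matM N u =
      ((u : ℂ) * (1 - u)) • ddmatM N u + dmatM N u * matT1 N u + matM N u * matT0 N := by
  rw [opDα_neg_F0, matT1_eq, mul_smul_comm]
  ext i j
  have h := congrArg (fun p : Polynomial ℝ => ((p.eval u : ℝ) : ℂ)) (matMPoly_ode i j)
  simp only [Polynomial.eval_mul, Polynomial.eval_sub, Polynomial.eval_C, Polynomial.eval_X,
    Polynomial.eval_add, Polynomial.eval_one, Polynomial.eval_zero] at h
  push_cast at h
  simp only [matT11, matT0, diag, Matrix.smul_apply, diagonal_mul, mul_diagonal, smul_eq_mul,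
    matM_apply, Matrix.add_apply, dmatM, ddmatM, of_apply]
  linear_combination -h

theorem isConjugate_opDα_neg :
    DiffOp.IsConjugate (matM N) (opDα N (-(N : ℝ))) (opDiag N) := by
  intro u G hG
  set F : ℝ → Mat N := fun v => G v * (matM N v)⁻¹ with hF
  have hF2 : C2At F u := hG.mul (c2At_matM_inv u)
  have hGF : G = fun v => F v * matM N v := by
    funext v; simp only [hF]; rw [mul_assoc, matM_inv_mul, mul_one]
  rw [hGF, DiffOp.act_mul _ hF2 hasMatDerivAt_matM (hasMatDerivAt_dmatM u), DiffOp.act]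
  simp only [add_mul, mul_assoc, opDα_neg_F1_mul_matM, opDα_neg_F0_mul_matM, opDα_F2]
  simp only [opDiag, mul_add, smul_mul_assoc, mul_smul_comm, one_mul, mul_one, smul_smul]
  rw [mul_comm (2 : ℂ)]
  abel

theorem isDiagonal_opDiag : (opDiag N).IsDiagonal := by
  intro u
  refine ⟨isDiag_one.smul _, ?_, isDiag_diagonal _⟩
  change (matT1 N u).IsDiag
  rw [matT1_eq]
  exact (isDiag_diagonal _).smul _

theorem eq_neg_of_isConjugate (hN : 1 ≤ N) {α : ℝ} {D' : DiffOp N} (hd : D'.IsDiagonal)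
    (h : DiffOp.IsConjugate (matM N) (opDα N α) D') : α = -(N : ℝ) := by
  -- At `0` this test function has value `0`, derivative `1` and second derivative `0`, so `D_α`
  -- applied to it gives exactly the first-order coefficient.
  let F : ℝ → Mat N := fun v => (v : ℂ) • 1
  have hF : C2At F 0 := by
    intro i j
    exact Complex.ofRealCLM.contDiff.contDiffAt.mul contDiffAt_const
  have h1 : ∀ v, HasMatDerivAt F 1 v := fun v => by
    have : HasDerivAt (fun v : ℝ => (v : ℂ)) 1 v := (hasDerivAt_id v).ofReal_comp
    intro i j
    simpa [F] using this.mul_const ((1 : Mat N) i j)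
  have h1' : matDeriv F = fun _ => 1 := funext fun v => (h1 v).matDeriv_eq
  have h2 : matDeriv (matDeriv F) 0 = 0 := by
    rw [h1']; ext i j; simp [matDeriv]
  have hFM : (fun v => F v * matM N v * (matM N v)⁻¹) = F := by
    funext v; rw [mul_assoc, matM_mul_inv, mul_one]
  have key := h 0 _ (hF.mul (c2At_matM 0))
  rw [hFM, DiffOp.act_mul _ hF hasMatDerivAt_matM (hasMatDerivAt_dmatM 0), DiffOp.act, h2, h1'] at key
  have hF0 : F 0 = 0 := by simp [F]
  simp only [hF0, zero_mul, one_mul, zero_add, add_zero] at key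
  obtain ⟨d2, d1, -⟩ := hd 0
  rw [← d2.diagonal_diag, ← d1.diagonal_diag] at key
  obtain ⟨n, rfl⟩ : ∃ n, N = n + 1 := ⟨N - 1, by omega⟩
  -- On the diagonal side this entry involves only `M'₀₁` and `M₀₁`, both zero. On the other side,
  -- tridiagonality together with `M₀₁ = 0` and `M₁₁ = 1` leaves the superdiagonal entry.
  have e := congrFun (congrFun key 0) 1
  have m01 : matMPoly 0 1 = 0 := matMPoly_of_lt (by norm_num)
  rw [Matrix.add_apply, mul_diagonal, mul_diagonal, Matrix.smul_apply, dmatM, of_apply, matM_apply,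
    mul_apply, sum_eq_single 1] at e
  · rw [matM_apply] at e
    have e' : (opDα (n + 1) α).F1 0 0 1 = 0 := by
      simpa [m01, matMPoly_self] using e
    change ((matC (n + 1) - ((0 : ℝ) : ℂ) • matU (n + 1)) +
      (α : ℂ) • (((0 : ℝ) : ℂ) • matB1 (n + 1) + matB0 (n + 1))) 0 1 = 0 at e'
    have hn : (n + 1 : ℂ) ≠ 0 := by exact_mod_cast n.succ_ne_zero
    simp [matC, matB0, tridiag] at e'
    field_simp at e'
    have : (α : ℂ) = ((-((n + 1 : ℕ) : ℝ) : ℝ) : ℂ) := by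
      push_cast
      linear_combination -e'
    exact_mod_cast this
  · intro k _ hk
    by_cases h0 : k = 0
    · subst h0
      rw [matM_apply]; simp [m01]
    · have h2 : 2 ≤ (k : ℕ) := by
        have a : (k : ℕ) ≠ 0 := fun h => h0 (Fin.ext h)
        have b : (k : ℕ) ≠ 1 := fun h => hk (Fin.ext (by simpa using h))
        omega
      have : (opDα (n + 1) α).F1 0 0 k = 0 := by
        change ((matC (n + 1) - ((0 : ℝ) : ℂ) • matU (n + 1)) +
          (α : ℂ) • (((0 : ℝ) : ℂ) • matB1 (n + 1) + matB0 (n + 1))) 0 k = 0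
        have a : (k : ℕ) ≠ 0 := by omega
        have b : (k : ℕ) ≠ 1 := by omega
        simp [matC, matB0, tridiag, a, b, h0]
      rw [this, zero_mul]
  · simp

end MVOP

/-! ### Contiguity relations of the weight coefficients. -/

namespace MVOP

open Filter Topology

theorem weightCoeff_contiguous {N t m n : ℕ} (htm : t < m) (hmn : m ≤ n) (hn : n ≤ N) :
    ∃ c : ℝ, (n + m + 1 - t) * weightCoeff N t m n = (N - n - m + t + 1) * c ∧
      (t + 1) * weightCoeff N (t + 1) m n = (N + 1 - t) * c ∧
      n * weightCoeff N t m (n - 1) = (N + 1 - n) * c ∧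
      m * weightCoeff N t (m - 1) n = (N + 1 - m) * c := by
  obtain ⟨r, rfl⟩ := Nat.exists_eq_add_of_lt htm
  obtain ⟨n, rfl⟩ : ∃ k, n = k + 1 := ⟨n - 1, by omega⟩
  obtain ⟨d, rfl⟩ := Nat.exists_eq_add_of_le hn
  -- The witness is `α_t(m,n)` with `m - t` replaced by `m - t - 1` in the sign and in both
  -- Pochhammer quotient factors. The coefficient `α_t(m,n)` itself cannot serve as common unit,
  -- since it vanishes for `n = N`.
  refine ⟨((n + 1 + d + 1 : ℝ) / (n + 1 + 1)) *
    (((n + 1 + d - (t + r + 1)).factorial * (t + r + 1).factorial : ℝ) / (n + 1 + d).factorial) *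
    (-1) ^ r * (poch ((n + 1 : ℝ) - (n + 1 + d)) r / poch ((n + 1 : ℝ) + 2) r) *
    (poch ((n + 1 + d : ℝ) + 2 - t) t / t.factorial), ?_⟩
  have e1 : t + r + 1 - t = r + 1 := by omega
  have e2 : t + r + 1 - (t + 1) = r := by omega
  have e3 : t + r - t = r := by omega
  have e4 : t + r + 1 - 1 = t + r := by omega
  have e5 : n + 1 + d - (t + r) = n + 1 + d - (t + r + 1) + 1 := by omega
  have e6 : ((n + 1 + d - (t + r + 1) : ℕ) : ℝ) = n + d - t - r := by
    rw [Nat.cast_sub (by omega)]; push_cast; ring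
  have p1 : poch ((n : ℝ) - (n + 1 + d)) (r + 1) =
      (n - (n + 1 + d)) * poch ((n + 1 : ℝ) - (n + 1 + d)) r := by
    rw [poch_succ_left]; congr 2; ring
  have p2 : poch ((n : ℝ) + 2) (r + 1) = (n + 2) * poch ((n + 1 : ℝ) + 2) r := by
    rw [poch_succ_left]; congr 2; ring
  have p3 : poch ((n + 1 + d : ℝ) + 2 - (t + 1)) (t + 1) =
      (n + 1 + d + 1 - t) * poch ((n + 1 + d : ℝ) + 2 - t) t := by
    rw [poch_succ_left, show (n + 1 + d : ℝ) + 2 - (t + 1) = n + 1 + d + 1 - t by ring]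
    congr 2; ring
  have q1 : poch ((n + 1 : ℝ) + 2) r ≠ 0 := (poch_pos (by positivity) r).ne'
  have q2 : ((n + 1 : ℝ) + 2 + r) ≠ 0 := by positivity
  have q3 : (t.factorial : ℝ) ≠ 0 := by positivity
  have q4 : ((n + 1 + d).factorial : ℝ) ≠ 0 := by positivity
  simp only [weightCoeff, e1, e2, e3, e4, Nat.add_sub_cancel, e5, Nat.factorial_succ (t + r),
    Nat.factorial_succ (n + 1 + d - (t + r + 1)), Nat.factorial_succ t]
  push_cast
  rw [e6, p1, p2, p3, poch_succ ((n + 1 : ℝ) - (n + 1 + d)), poch_succ ((n + 1 : ℝ) + 2)]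
  generalize poch ((n + 1 : ℝ) + 2) r = P1 at *
  generalize poch ((n + 1 : ℝ) - (n + 1 + d)) r = P2 at *
  generalize poch ((n + 1 + d : ℝ) + 2 - t) t = P3 at *
  generalize ((n + 1 + d).factorial : ℝ) = P4 at *
  generalize ((n + 1 + d - (t + r + 1)).factorial : ℝ) = P5 at *
  rw [pow_succ]
  generalize (-1 : ℝ) ^ r = P6 at *
  refine ⟨?_, ?_, ?_, ?_⟩
  all_goals
    field_simp
    try ring1

theorem weightCoeff_self {N m n : ℕ} (hmn : m < n) :
    n * weightCoeff N m m (n - 1) = (n + 1) * weightCoeff N m m n := by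
  obtain ⟨n, rfl⟩ : ∃ k, n = k + 1 := ⟨n - 1, by omega⟩
  simp only [weightCoeff, Nat.sub_self, poch_zero, Nat.add_sub_cancel]
  push_cast
  field_simp

/-- With `f t = sin((n+m+2-2t)θ)` this is the formula for `(1-x²) W'`. Collecting the terms in `f
(t+1)`, it says `(N-n-m+t+1) + (N+1-t) = (N+1-n) + (N+1-m)`; the end term `t = m` is
`weightCoeff_self`. -/
theorem sum_weightCoeff_first {N n m : ℕ} (hmn : m < n) (hn : n ≤ N) (f : ℕ → ℝ) :
    ∑ t ∈ range (m + 1), weightCoeff N t m n * (t * f t + (n + m + 1 - t) * f (t + 1)) =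
      n * ∑ t ∈ range (m + 1), weightCoeff N t m (n - 1) * f (t + 1) +
        m * ∑ t ∈ range m, weightCoeff N t (m - 1) n * f (t + 1) := by
  have h1 : ∑ t ∈ range (m + 1), weightCoeff N t m n * (t * f t) =
      ∑ t ∈ range m, (t + 1) * weightCoeff N (t + 1) m n * f (t + 1) := by
    rw [sum_range_succ']
    simp only [Nat.cast_zero, zero_mul, mul_zero, add_zero]
    exact sum_congr rfl fun t _ => by push_cast; ring
  simp only [mul_add, sum_add_distrib, h1]
  rw [sum_range_succ _ m, sum_range_succ _ m, mul_add, mul_sum, mul_sum]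
  have h2 := weightCoeff_self (N := N) hmn
  have h3 : ∑ t ∈ range m, (t + 1) * weightCoeff N (t + 1) m n * f (t + 1) +
      ∑ t ∈ range m, weightCoeff N t m n * ((n + m + 1 - t) * f (t + 1)) =
      ∑ t ∈ range m, (n : ℝ) * (weightCoeff N t m (n - 1) * f (t + 1)) +
      ∑ t ∈ range m, (m : ℝ) * (weightCoeff N t (m - 1) n * f (t + 1)) := by
    rw [← sum_add_distrib, ← sum_add_distrib]
    refine sum_congr rfl fun t ht => ?_
    obtain ⟨c, c1, c2, c3, c4⟩ := weightCoeff_contiguous (mem_range.1 ht) hmn.le hn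
    linear_combination f (t + 1) * (c1 + c2 - c3 - c4)
  linear_combination h3 - f (m + 1) * h2

theorem sum_weightCoeff_first_diag {N n : ℕ} (hn : n ≤ N) (f : ℕ → ℝ) (hf : f (n + 1) = 0) :
    ∑ t ∈ range (n + 1), weightCoeff N t n n * (t * f t + (n + n + 1 - t) * f (t + 1)) =
      2 * (n * ∑ t ∈ range n, weightCoeff N t (n - 1) n * f (t + 1)) := by
  have h1 : ∑ t ∈ range (n + 1), weightCoeff N t n n * (t * f t) =
      ∑ t ∈ range n, (t + 1) * weightCoeff N (t + 1) n n * f (t + 1) := by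
    rw [sum_range_succ']
    simp only [Nat.cast_zero, zero_mul, mul_zero, add_zero]
    exact sum_congr rfl fun t _ => by push_cast; ring
  simp only [mul_add, sum_add_distrib, h1]
  rw [sum_range_succ _ n, hf, mul_zero, mul_zero, add_zero, ← sum_add_distrib, mul_sum, mul_sum]
  refine sum_congr rfl fun t ht => ?_
  obtain ⟨c, c1, c2, c3, c4⟩ := weightCoeff_contiguous (mem_range.1 ht) le_rfl hn
  linear_combination f (t + 1) * (c1 + c2 - 2 * c4)

/-- With `g t = cos((n+m+2-2t)θ)` this is the entry of `K' = T₀ W - W T₀` multiplied by `-√(1-x²)`.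
-/
theorem sum_weightCoeff_second {N n m : ℕ} (hmn : m < n) (hn : n ≤ N) (g : ℕ → ℝ) :
    (m - n) / 2 * ∑ t ∈ range (m + 1),
        weightCoeff N t m n * ((n + m + 2 - 2 * t) * g t + (n + m - 2 * t) * g (t + 1)) +
      n * ∑ t ∈ range (m + 1), weightCoeff N t m (n - 1) * ((n + m - 2 * t) * g (t + 1)) -
        m * ∑ t ∈ range m, weightCoeff N t (m - 1) n * ((n + m - 2 * t) * g (t + 1)) =
      (m - n) / 2 * (n + m + 2) * ∑ t ∈ range (m + 1), weightCoeff N t m n * (g t - g (t + 1)) := by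
  have h1 : ∑ t ∈ range (m + 1), weightCoeff N t m n * ((n + m + 2 - 2 * t) * g t) =
      ∑ t ∈ range m, weightCoeff N (t + 1) m n * ((n + m - 2 * t) * g (t + 1)) +
        weightCoeff N 0 m n * ((n + m + 2) * g 0) := by
    rw [sum_range_succ']
    congr 1
    · exact sum_congr rfl fun t _ => by push_cast; ring
    · push_cast; ring
  have h2 : ∑ t ∈ range (m + 1), weightCoeff N t m n * g t =
      ∑ t ∈ range m, weightCoeff N (t + 1) m n * g (t + 1) + weightCoeff N 0 m n * g 0 :=
    sum_range_succ' _ _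
  have h3 : ∑ t ∈ range m, ((m - n) / 2 * (weightCoeff N (t + 1) m n * ((n + m - 2 * t) * g (t + 1)))
      + (m - n) / 2 * (weightCoeff N t m n * ((n + m - 2 * t) * g (t + 1)))
      + n * (weightCoeff N t m (n - 1) * ((n + m - 2 * t) * g (t + 1)))
      - m * (weightCoeff N t (m - 1) n * ((n + m - 2 * t) * g (t + 1)))
      - (m - n) / 2 * (n + m + 2) * (weightCoeff N (t + 1) m n * g (t + 1))
      + (m - n) / 2 * (n + m + 2) * (weightCoeff N t m n * g (t + 1))) = 0 := by
    refine sum_eq_zero fun t ht => ?_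
    obtain ⟨c, c1, c2, c3, c4⟩ := weightCoeff_contiguous (mem_range.1 ht) hmn.le hn
    linear_combination g (t + 1) * ((m - n : ℝ) * (c1 - c2) + (n + m - 2 * t) * (c3 - c4))
  simp only [mul_add, mul_sub, sum_add_distrib, sum_sub_distrib] at h3 ⊢
  simp only [← mul_add, ← mul_sub]
  simp only [← mul_sum] at h3
  rw [h1, h2, sum_range_succ _ m, sum_range_succ _ m, sum_range_succ _ m]
  have h4 := weightCoeff_self (N := N) hmn
  linear_combination h3 + (n - m) * g (m + 1) * h4

end MVOP

/-! ### The weight as a sine sum in `θ = arccos x`, and its first-order relations. -/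

namespace MVOP

open Filter Topology

/-- `sin (j θ)` as a function of `x = cos θ`. -/
noncomputable def sinArccos (j x : ℝ) : ℝ := Real.sin (j * Real.arccos x)

/-- `cos (j θ)` as a function of `x = cos θ`. -/
noncomputable def cosArccos (j x : ℝ) : ℝ := Real.cos (j * Real.arccos x)

theorem hasDerivAt_sinArccos (j : ℝ) {x : ℝ} (hx : x ∈ Set.Ioo (-1 : ℝ) 1) :
    HasDerivAt (sinArccos j) (-(j * cosArccos j x / √(1 - x ^ 2))) x := by
  have h := (((Real.hasDerivAt_arccos hx.1.ne' hx.2.ne).const_mul j).sin)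
  refine h.congr_deriv ?_
  simp only [cosArccos]; ring

theorem mul_sinArccos (j : ℝ) {x : ℝ} (hx : x ∈ Set.Icc (-1 : ℝ) 1) :
    x * sinArccos j x = (sinArccos (j + 1) x + sinArccos (j - 1) x) / 2 := by
  have h := Real.cos_arccos hx.1 hx.2
  simp only [sinArccos, add_mul, sub_mul, one_mul, Real.sin_add, Real.sin_sub, h]
  ring

theorem sqrt_mul_sinArccos (j x : ℝ) :
    √(1 - x ^ 2) * sinArccos j x = (cosArccos (j - 1) x - cosArccos (j + 1) x) / 2 := by
  simp only [sinArccos, cosArccos, add_mul, sub_mul, one_mul, Real.cos_add, Real.cos_sub,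
    Real.sin_arccos]
  ring

theorem sqrt_mul_cosArccos (j x : ℝ) :
    √(1 - x ^ 2) * cosArccos j x = (sinArccos (j + 1) x - sinArccos (j - 1) x) / 2 := by
  simp only [sinArccos, cosArccos, add_mul, sub_mul, one_mul, Real.sin_add, Real.sin_sub,
    Real.sin_arccos]
  ring

theorem weightEntry_eq_sum (N : ℕ) {n m : ℕ} (hmn : m ≤ n) {x : ℝ} (hx : x ∈ Set.Icc (-1 : ℝ) 1) :
    weightEntry N n m x =
      ∑ t ∈ range (m + 1), weightCoeff N t m n * sinArccos (n + m + 1 - 2 * t) x := by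
  rw [weightEntry, mul_sum]
  refine sum_congr rfl fun t ht => ?_
  have ht : t ≤ m := by simpa [Nat.lt_succ_iff] using ht
  have h := Polynomial.Chebyshev.U_real_cos (Real.arccos x) ((n + m - 2 * t : ℕ) : ℤ)
  rw [Real.cos_arccos hx.1 hx.2, Real.sin_arccos] at h
  have e : ((((n + m - 2 * t : ℕ) : ℤ) : ℝ) + 1) = n + m + 1 - 2 * t := by
    rw [Int.cast_natCast, Nat.cast_sub (by omega)]; push_cast; ring
  rw [e] at h
  rw [sinArccos, ← h]
  ring

theorem hasDerivAt_weightEntry (N : ℕ) {n m : ℕ} (hmn : m ≤ n) {x : ℝ}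
    (hx : x ∈ Set.Ioo (-1 : ℝ) 1) :
    HasDerivAt (weightEntry N n m) (∑ t ∈ range (m + 1), weightCoeff N t m n *
      -((n + m + 1 - 2 * t) * cosArccos (n + m + 1 - 2 * t) x / √(1 - x ^ 2))) x := by
  have h : HasDerivAt (fun y => ∑ t ∈ range (m + 1),
      weightCoeff N t m n * sinArccos (n + m + 1 - 2 * t) y) _ x :=
    HasDerivAt.fun_sum fun t _ => (hasDerivAt_sinArccos (n + m + 1 - 2 * t) hx).const_mul _
  refine h.congr_of_eventuallyEq ?_
  filter_upwards [Icc_mem_nhds hx.1 hx.2] with y hy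
  exact weightEntry_eq_sum N hmn hy

/-- The entries of the weight for all pairs of natural numbers. -/
noncomputable def weightFun (N n m : ℕ) (x : ℝ) : ℝ :=
  if m ≤ n then weightEntry N n m x else weightEntry N m n x

theorem weightFun_comm (N n m : ℕ) : weightFun N n m = weightFun N m n := by
  funext x
  rcases lt_trichotomy n m with h | rfl | h
  · simp [weightFun, h.le, h.not_ge]
  · rfl
  · simp [weightFun, h.le, h.not_ge]

theorem weightFun_of_le (N : ℕ) {n m : ℕ} (h : m ≤ n) : weightFun N n m = weightEntry N n m := by
  funext x; simp [weightFun, h]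

theorem weight_apply (N : ℕ) (x : ℝ) (i j : Fin (N + 1)) :
    weight N x i j = (weightFun N i j x : ℂ) := by
  simp only [weight, weightFun, of_apply]
  split_ifs <;> rfl

theorem continuous_weightFun (N n m : ℕ) : Continuous (weightFun N n m) := by
  unfold weightFun weightEntry
  split_ifs <;> fun_prop

theorem weightFun_eq_zero (N n m : ℕ) {x : ℝ} (hx : x ^ 2 = 1) : weightFun N n m x = 0 := by
  simp [weightFun, weightEntry, hx]

/-- The derivative of `weightFun` on `(-1, 1)`, given by
`(1 - x²) W_{n,m}' = -(n + m + 1) x W_{n,m} + n W_{n-1,m} + m W_{n,m-1}`. -/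
noncomputable def weightFunDeriv (N n m : ℕ) (x : ℝ) : ℝ :=
  (-((n + m + 1) * x * weightFun N n m x) + n * weightFun N (n - 1) m x +
    m * weightFun N n (m - 1) x) / (1 - x ^ 2)

theorem sum_weightCoeff_deriv (N : ℕ) {n m : ℕ} {x : ℝ} (hx : x ∈ Set.Ioo (-1 : ℝ) 1) :
    (1 - x ^ 2) * (∑ t ∈ range (m + 1), weightCoeff N t m n *
      -((n + m + 1 - 2 * t) * cosArccos (n + m + 1 - 2 * t) x / √(1 - x ^ 2))) +
      (n + m + 1) * x * ∑ t ∈ range (m + 1), weightCoeff N t m n * sinArccos (n + m + 1 - 2 * t) x =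
    ∑ t ∈ range (m + 1), weightCoeff N t m n * (t * sinArccos (n + m + 2 - 2 * t) x +
      (n + m + 1 - t) * sinArccos (n + m + 2 - 2 * (t + 1 : ℕ)) x) := by
  have hp : 0 < 1 - x ^ 2 := by nlinarith [hx.1, hx.2]
  have hs := Real.sq_sqrt hp.le
  have hs0 : √(1 - x ^ 2) ≠ 0 := (Real.sqrt_pos.2 hp).ne'
  rw [mul_sum, mul_sum, ← sum_add_distrib]
  refine sum_congr rfl fun t _ => ?_
  have h1 := mul_sinArccos (n + m + 1 - 2 * t) (Set.Ioo_subset_Icc_self hx)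
  have h2 := sqrt_mul_cosArccos (n + m + 1 - 2 * t) x
  rw [show (n + m + 1 - 2 * t : ℝ) + 1 = n + m + 2 - 2 * t by ring,
    show (n + m + 1 - 2 * t : ℝ) - 1 = n + m + 2 - 2 * (t + 1 : ℕ) by push_cast; ring] at h1 h2
  have h3 : (1 - x ^ 2) * (cosArccos (n + m + 1 - 2 * t) x / √(1 - x ^ 2)) =
      √(1 - x ^ 2) * cosArccos (n + m + 1 - 2 * t) x := by
    rw [← hs, mul_div_assoc', div_eq_iff (by rwa [hs])]
    rw [hs]
    linear_combination -cosArccos (n + m + 1 - 2 * t) x * hs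
  linear_combination weightCoeff N t m n *
    ((n + m + 1) * h1 - (n + m + 1 - 2 * t) * (h2 + h3))

theorem hasDerivAt_weightFun {N n m : ℕ} (hn : n ≤ N) (hm : m ≤ N) {x : ℝ}
    (hx : x ∈ Set.Ioo (-1 : ℝ) 1) :
    HasDerivAt (weightFun N n m) (weightFunDeriv N n m x) x := by
  wlog hmn : m ≤ n generalizing n m
  · rw [weightFun_comm]
    refine (this hm hn (by omega)).congr_deriv ?_
    rw [weightFunDeriv, weightFunDeriv, weightFun_comm N n m, weightFun_comm N (n - 1) m,
      weightFun_comm N n (m - 1)]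
    ring
  have hx' := Set.Ioo_subset_Icc_self hx
  have hp : 0 < 1 - x ^ 2 := by nlinarith [hx.1, hx.2]
  rw [weightFun_of_le N hmn]
  refine (hasDerivAt_weightEntry N hmn hx).congr_deriv (Eq.symm ?_)
  have h := sum_weightCoeff_deriv N (n := n) (m := m) hx
  rw [weightFunDeriv, div_eq_iff hp.ne', weightFun_of_le N hmn, weightEntry_eq_sum N hmn hx']
  rcases hmn.lt_or_eq with hlt | rfl
  · have hs := sum_weightCoeff_first hlt hn fun t => sinArccos (n + m + 2 - 2 * t) x
    rw [weightFun_of_le N (show m ≤ n - 1 by omega), weightFun_of_le N (show m - 1 ≤ n by omega),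
      weightEntry_eq_sum N (show m ≤ n - 1 by omega) hx',
      weightEntry_eq_sum N (show m - 1 ≤ n by omega) hx']
    have e1 : ∑ t ∈ range (m + 1), weightCoeff N t m (n - 1) *
        sinArccos ((n - 1 : ℕ) + m + 1 - 2 * t) x = ∑ t ∈ range (m + 1),
          weightCoeff N t m (n - 1) * sinArccos (n + m + 2 - 2 * (t + 1 : ℕ)) x := by
      refine sum_congr rfl fun t _ => ?_
      rw [Nat.cast_sub (by omega)]; congr 2; push_cast; ring
    have e2 : (m : ℝ) * ∑ t ∈ range (m - 1 + 1), weightCoeff N t (m - 1) n *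
        sinArccos (n + (m - 1 : ℕ) + 1 - 2 * t) x = m * ∑ t ∈ range m,
          weightCoeff N t (m - 1) n * sinArccos (n + m + 2 - 2 * (t + 1 : ℕ)) x := by
      cases m with
      | zero => simp
      | succ m =>
        congr 1
        refine sum_congr rfl fun t _ => ?_
        congr 2; push_cast; ring_nf
    rw [e1, e2]
    linear_combination -hs - h
  -- On the diagonal the two neighbours `W_{m-1,m}` and `W_{m,m-1}` coincide, and the end term
  -- disappears because its sine is `sin 0`.
  · have hs := sum_weightCoeff_first_diag hn (fun t => sinArccos (m + m + 2 - 2 * t) x) (by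
      simp only [sinArccos]; push_cast; ring_nf; simp)
    have e2 : (m : ℝ) * weightFun N m (m - 1) x = m * ∑ t ∈ range m,
          weightCoeff N t (m - 1) m * sinArccos (m + m + 2 - 2 * (t + 1 : ℕ)) x := by
      rw [weightFun_of_le N (show m - 1 ≤ m by omega),
        weightEntry_eq_sum N (show m - 1 ≤ m by omega) hx']
      cases m with
      | zero => simp
      | succ m =>
        congr 1
        refine sum_congr rfl fun t _ => ?_
        congr 2; push_cast; ring_nf
    rw [weightFun_comm N (m - 1) m]
    linear_combination -hs - h + 2 * e2

/-- The function `(m - n) x W_{n,m} + n W_{n-1,m} - m W_{n,m-1}`, antisymmetric in `n` and `m`. -/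
noncomputable def weightSkew (N n m : ℕ) (x : ℝ) : ℝ :=
  (m - n) * x * weightFun N n m x + n * weightFun N (n - 1) m x - m * weightFun N n (m - 1) x

theorem hasDerivAt_weightSkew {N n m : ℕ} (hn : n ≤ N) (hm : m ≤ N) {x : ℝ}
    (hx : x ∈ Set.Ioo (-1 : ℝ) 1) :
    HasDerivAt (weightSkew N n m) ((m - n) * (m + n + 2) * weightFun N n m x) x := by
  wlog hmn : m ≤ n generalizing n m
  · have e : weightSkew N n m = fun x => -weightSkew N m n x := by
      funext x
      rw [weightSkew, weightSkew, weightFun_comm N n m, weightFun_comm N (n - 1) m,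
        weightFun_comm N n (m - 1)]
      ring
    rw [e]
    refine (this hm hn (by omega)).neg.congr_deriv ?_
    rw [weightFun_comm N n m]; ring
  rcases hmn.lt_or_eq with hlt | rfl
  swap
  · have e : weightSkew N m m = fun x => 0 := by
      funext x
      rw [weightSkew, weightFun_comm N (m - 1) m]
      ring
    rw [e, sub_self, zero_mul, zero_mul]
    exact hasDerivAt_const x 0
  have hp : 0 < 1 - x ^ 2 := by nlinarith [hx.1, hx.2]
  have hs0 : √(1 - x ^ 2) ≠ 0 := (Real.sqrt_pos.2 hp).ne'
  have eqv : ∀ y ∈ Set.Icc (-1 : ℝ) 1, weightSkew N n m y =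
      (m - n) / 2 * ∑ t ∈ range (m + 1), weightCoeff N t m n *
        (sinArccos (n + m + 2 - 2 * t) y + sinArccos (n + m - 2 * t) y) +
      n * ∑ t ∈ range (m + 1), weightCoeff N t m (n - 1) * sinArccos (n + m - 2 * t) y -
        m * ∑ t ∈ range m, weightCoeff N t (m - 1) n * sinArccos (n + m - 2 * t) y := by
    intro y hy
    rw [weightSkew, weightFun_of_le N hmn, weightFun_of_le N (show m ≤ n - 1 by omega),
      weightFun_of_le N (show m - 1 ≤ n by omega), weightEntry_eq_sum N hmn hy,
      weightEntry_eq_sum N (show m ≤ n - 1 by omega) hy,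
      weightEntry_eq_sum N (show m - 1 ≤ n by omega) hy]
    congr 1
    · congr 1
      · rw [mul_sum, mul_sum]
        refine sum_congr rfl fun t _ => ?_
        have h1 := mul_sinArccos (n + m + 1 - 2 * t) hy
        rw [show (n + m + 1 - 2 * t : ℝ) + 1 = n + m + 2 - 2 * t by ring,
          show (n + m + 1 - 2 * t : ℝ) - 1 = n + m - 2 * t by ring] at h1
        linear_combination (m - n : ℝ) * weightCoeff N t m n * h1
      · congr 1
        refine sum_congr rfl fun t _ => ?_
        rw [Nat.cast_sub (by omega)]; congr 2; push_cast; ring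
    · cases m with
      | zero => simp
      | succ m =>
        congr 1
        refine sum_congr rfl fun t _ => ?_
        congr 2; push_cast [Nat.add_sub_cancel]; ring_nf
  have hd : ∀ j : ℝ, HasDerivAt (sinArccos j) _ x := fun j => hasDerivAt_sinArccos j hx
  have h : HasDerivAt (fun y => (m - n) / 2 * ∑ t ∈ range (m + 1), weightCoeff N t m n *
        (sinArccos (n + m + 2 - 2 * t) y + sinArccos (n + m - 2 * t) y) +
      n * ∑ t ∈ range (m + 1), weightCoeff N t m (n - 1) * sinArccos (n + m - 2 * t) y -
        m * ∑ t ∈ range m, weightCoeff N t (m - 1) n * sinArccos (n + m - 2 * t) y) _ x :=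
    (((HasDerivAt.fun_sum fun t _ => ((hd _).add (hd _)).const_mul _).const_mul _).add
      ((HasDerivAt.fun_sum fun t _ => (hd _).const_mul _).const_mul _)).sub
      ((HasDerivAt.fun_sum fun t _ => (hd _).const_mul _).const_mul _)
  have h' := h.congr_of_eventuallyEq (f₁ := weightSkew N n m)
    (by filter_upwards [Icc_mem_nhds hx.1 hx.2] with y hy using eqv y hy)
  refine h'.congr_deriv (Eq.symm ?_)
  have hs := sum_weightCoeff_second hlt hn fun t => cosArccos (n + m + 2 - 2 * t) x
  rw [weightFun_of_le N hmn, weightEntry_eq_sum N hmn (Set.Ioo_subset_Icc_self hx)]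
  have e (t : ℕ) : (n + m + 2 - 2 * (t + 1 : ℕ) : ℝ) = n + m - 2 * t := by push_cast; ring
  simp only [e] at hs
  apply mul_left_cancel₀ hs0
  have l1 : √(1 - x ^ 2) * ∑ t ∈ range (m + 1), weightCoeff N t m n *
      sinArccos (n + m + 1 - 2 * t) x = -(∑ t ∈ range (m + 1), weightCoeff N t m n *
      (cosArccos (n + m + 2 - 2 * t) x - cosArccos (n + m - 2 * t) x)) / 2 := by
    rw [mul_sum, ← sum_neg_distrib, sum_div]
    refine sum_congr rfl fun t _ => ?_
    have h1 := sqrt_mul_sinArccos (n + m + 1 - 2 * t) x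
    rw [show (n + m + 1 - 2 * t : ℝ) + 1 = n + m + 2 - 2 * t by ring,
      show (n + m + 1 - 2 * t : ℝ) - 1 = n + m - 2 * t by ring] at h1
    linear_combination weightCoeff N t m n * h1
  have l2 : √(1 - x ^ 2) * ∑ t ∈ range (m + 1), weightCoeff N t m n *
      (-((n + m + 2 - 2 * t) * cosArccos (n + m + 2 - 2 * t) x / √(1 - x ^ 2)) +
        -((n + m - 2 * t) * cosArccos (n + m - 2 * t) x / √(1 - x ^ 2))) =
      -(∑ t ∈ range (m + 1), weightCoeff N t m n *
        ((n + m + 2 - 2 * t) * cosArccos (n + m + 2 - 2 * t) x +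
          (n + m - 2 * t) * cosArccos (n + m - 2 * t) x)) := by
    rw [mul_sum, ← sum_neg_distrib]
    refine sum_congr rfl fun t _ => ?_
    field_simp
    ring
  have l3 (r : ℕ) (a : ℕ → ℝ) : √(1 - x ^ 2) * ∑ t ∈ range r, a t *
      -((n + m - 2 * t) * cosArccos (n + m - 2 * t) x / √(1 - x ^ 2)) =
      -(∑ t ∈ range r, a t * ((n + m - 2 * t) * cosArccos (n + m - 2 * t) x)) := by
    rw [mul_sum, ← sum_neg_distrib]
    refine sum_congr rfl fun t _ => ?_
    field_simp
  linear_combination (m - n : ℝ) * (m + n + 2) * l1 - (m - n : ℝ) / 2 * l2 -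
    n * l3 (m + 1) (fun t => weightCoeff N t m (n - 1)) +
    m * l3 m (fun t => weightCoeff N t (m - 1) n) + hs

end MVOP

/-! ### Matrix polynomials, the inner product, and the operator in the variable `x`. -/

namespace MVOP

open Polynomial

variable {N : ℕ}

theorem polyVal_eq_eval (P : (Mat N)[X]) (x : ℝ) : polyVal P x = P.eval ((x : ℂ) • 1) := by
  rw [polyVal, eval_eq_sum_range]
  refine sum_congr rfl fun k _ => ?_
  rw [_root_.smul_pow, one_pow, mul_smul_comm, mul_one]

theorem polyVal_add (P Q : (Mat N)[X]) (x : ℝ) : polyVal (P + Q) x = polyVal P x + polyVal Q x := by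
  simp only [polyVal_eq_eval, eval_add]

theorem polyVal_sub (P Q : (Mat N)[X]) (x : ℝ) : polyVal (P - Q) x = polyVal P x - polyVal Q x := by
  simp only [polyVal_eq_eval, eval_sub]

/-- Evaluation is multiplicative over this noncommutative ring because the point is a scalar matrix,
hence central. -/
theorem polyVal_mul (P Q : (Mat N)[X]) (x : ℝ) : polyVal (P * Q) x = polyVal P x * polyVal Q x := by
  simp only [polyVal_eq_eval, eval]
  exact eval₂_mul_noncomm _ _ fun k => (Commute.one_right _).smul_right _

theorem polyVal_C (A : Mat N) (x : ℝ) : polyVal (C A) x = A := by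
  rw [polyVal_eq_eval, eval_C]

theorem polyVal_X (x : ℝ) : polyVal (X : (Mat N)[X]) x = (x : ℂ) • 1 := by
  rw [polyVal_eq_eval, eval_X]

theorem continuous_polyVal (P : (Mat N)[X]) : Continuous (polyVal P) := by
  unfold polyVal
  fun_prop

theorem hasMatDerivAt_polyVal (P : (Mat N)[X]) (x : ℝ) :
    HasMatDerivAt (polyVal P) (polyVal (derivative P) x) x := by
  induction P using Polynomial.induction_on' with
  | add P Q hP hQ =>
    rw [derivative_add, polyVal_add]
    rw [show polyVal (P + Q) = fun y => polyVal P y + polyVal Q y from funext (polyVal_add P Q)]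
    exact hP.add hQ
  | monomial n A =>
    have e (n : ℕ) (A : Mat N) (y : ℝ) : polyVal (monomial n A) y = ((y : ℂ) ^ n) • A := by
      rw [polyVal_eq_eval, eval_monomial, _root_.smul_pow, one_pow, mul_smul_comm, mul_one]
    rw [show polyVal (monomial n A) = fun y : ℝ => ((y : ℂ) ^ n) • A from funext (e n A),
      derivative_monomial, e]
    intro i j
    have h : HasDerivAt (fun y : ℝ => (y : ℂ)) 1 x := (hasDerivAt_id x).ofReal_comp
    refine ((h.fun_pow n).mul_const (A i j)).congr_deriv ?_
    rw [← nsmul_eq_mul']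
    simp only [Matrix.smul_apply, smul_eq_mul]
    rw [nsmul_eq_mul]
    ring

theorem continuous_weight : Continuous (weight N) :=
  continuous_matrix fun i j => by
    simp only [weight_apply]
    exact Complex.continuous_ofReal.comp (continuous_weightFun N i j)

theorem continuous_integrand (P Q : (Mat N)[X]) :
    Continuous fun x => polyVal P x * weight N x * (polyVal Q x)ᴴ :=
  ((continuous_polyVal P).matrix_mul continuous_weight).matrix_mul
    (continuous_polyVal Q).matrix_conjTranspose

theorem intervalIntegrable_integrand (P Q : (Mat N)[X]) (i j : Fin (N + 1)) :
    IntervalIntegrable (fun x => (polyVal P x * weight N x * (polyVal Q x)ᴴ) i j)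
      MeasureTheory.volume (-1) 1 :=
  ((continuous_integrand P Q).matrix_elem i j).intervalIntegrable _ _

theorem matInner_add_left (P Q R : (Mat N)[X]) :
    matInner (P + Q) R = matInner P R + matInner Q R := by
  ext i j
  simp only [matInner, of_apply, Matrix.add_apply]
  rw [← intervalIntegral.integral_add (intervalIntegrable_integrand P R i j)
    (intervalIntegrable_integrand Q R i j)]
  simp only [polyVal_add, add_mul, Matrix.add_apply]

theorem matInner_C_mul_left (A : Mat N) (P R : (Mat N)[X]) :
    matInner (C A * P) R = A * matInner P R := by
  ext i j
  simp only [matInner, of_apply, mul_apply (M := A)]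
  simp only [← intervalIntegral.integral_const_mul]
  rw [← intervalIntegral.integral_finsetSum
    fun k _ => (intervalIntegrable_integrand P R k j).const_mul _]
  simp only [polyVal_mul, polyVal_C, mul_assoc, mul_apply (M := A)]

theorem matInner_sub_left (P Q R : (Mat N)[X]) :
    matInner (P - Q) R = matInner P R - matInner Q R := by
  rw [eq_sub_iff_add_eq, ← matInner_add_left, sub_add_cancel]

theorem conjTranspose_weight (x : ℝ) : (weight N x)ᴴ = weight N x := by
  ext i j
  simp [conjTranspose_apply, weight_apply, weightFun_comm N i j]

theorem conjTranspose_matInner (P Q : (Mat N)[X]) : (matInner P Q)ᴴ = matInner Q P := by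
  ext i j
  simp only [conjTranspose_apply, matInner, of_apply]
  rw [intervalIntegral.integral_of_le (by norm_num), intervalIntegral.integral_of_le (by norm_num)]
  refine integral_conj.symm.trans (MeasureTheory.integral_congr_ae (.of_forall fun x => ?_))
  change ((polyVal P x * weight N x * (polyVal Q x)ᴴ)ᴴ) i j =
    (polyVal Q x * weight N x * (polyVal P x)ᴴ) i j
  rw [conjTranspose_mul, conjTranspose_mul, conjTranspose_conjTranspose, conjTranspose_weight,
    mul_assoc]

theorem matInner_eq_zero_of_coeff {P : ℕ → (Mat N)[X]} (hP : IsMonicOrthogonal N P) (d : ℕ) :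
    ∀ R : (Mat N)[X], (∀ k, d ≤ k → R.coeff k = 0) → ∀ n, d ≤ n → matInner R (P n) = 0 := by
  induction d with
  | zero =>
    intro R hR n _
    have : R = 0 := Polynomial.ext fun k => by simpa using hR k k.zero_le
    subst this
    simpa using matInner_C_mul_left 0 0 (P n)
  | succ d ih =>
    intro R hR n hn
    have h := ih (R - C (R.coeff d) * P d) (fun k hk => ?_) n (by omega)
    · rw [matInner_sub_left, matInner_C_mul_left, hP.orthogonal d n (by omega), mul_zero,
        sub_zero] at h
      exact h
    · rw [coeff_sub, coeff_C_mul]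
      rcases hk.eq_or_lt with rfl | hlt
      · rw [hP.monic, mul_one, sub_self]
      · rw [hR k hlt, coeff_eq_zero_of_natDegree_lt (p := P d) (by rwa [hP.natDegree_eq]), mul_zero, sub_zero]

theorem eq_zero_of_matInner {P : ℕ → (Mat N)[X]} (hP : IsMonicOrthogonal N P) (d : ℕ) :
    ∀ R : (Mat N)[X], (∀ k, d ≤ k → R.coeff k = 0) → (∀ n, n < d → matInner R (P n) = 0) →
      R = 0 := by
  induction d with
  | zero =>
    intro R hR _
    exact Polynomial.ext fun k => by simpa using hR k k.zero_le
  | succ d ih =>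
    intro R hR h
    have hlow : ∀ k, d ≤ k → (R - C (R.coeff d) * P d).coeff k = 0 := fun k hk => by
      rw [coeff_sub, coeff_C_mul]
      rcases hk.eq_or_lt with rfl | hlt
      · rw [hP.monic, mul_one, sub_self]
      · rw [hR k hlt, coeff_eq_zero_of_natDegree_lt (p := P d) (by rwa [hP.natDegree_eq]), mul_zero, sub_zero]
    -- Pairing with `P d` isolates the coefficient of degree `d` times the norm of `P d`, which is
    -- invertible by positive definiteness.
    have h0 := matInner_eq_zero_of_coeff hP d _ hlow d le_rfl
    rw [matInner_sub_left, matInner_C_mul_left, h d (by omega), zero_sub, neg_eq_zero] at h0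
    have hc : R.coeff d = 0 := by
      have hu : IsUnit (matInner (P d) (P d)) := (hP.posDef d).isUnit
      exact hu.mul_left_eq_zero.1 h0
    refine ih R (fun k hk => ?_) fun n hn => h n (by omega)
    rcases hk.eq_or_lt with rfl | hlt
    · exact hc
    · exact hR k hlt

/-- The coefficient of `d/dx` in the variable `x = 1 - 2u`. -/
noncomputable def firstCoeff (N : ℕ) (x : ℝ) : Mat N := (2 : ℂ) • lowerShift N - (x : ℂ) • matT11 N

/-- `D_{-2ℓ}` in the variable `x = 1 - 2u`, acting on polynomials. -/
noncomputable def xAct (P : (Mat N)[X]) : (Mat N)[X] :=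
  (derivative (derivative P) - X * (X * derivative (derivative P))) +
    derivative P * (C ((2 : ℂ) • lowerShift N) - X * C (matT11 N)) + P * C (matT0 N)

theorem polyVal_xAct (P : (Mat N)[X]) (x : ℝ) :
    polyVal (xAct P) x = (1 - x ^ 2 : ℂ) • polyVal (derivative (derivative P)) x +
      polyVal (derivative P) x * firstCoeff N x + polyVal P x * matT0 N := by
  simp only [xAct, polyVal_add, polyVal_sub, polyVal_mul, polyVal_C, polyVal_X, firstCoeff,
    smul_mul_assoc, one_mul, smul_smul, sub_smul, one_smul, sq]

theorem coeff_xAct_of_lt {P : (Mat N)[X]} {n k : ℕ} (h : ∀ k, n < k → P.coeff k = 0)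
    (hk : n < k) : (xAct P).coeff k = 0 := by
  obtain ⟨k, rfl⟩ : ∃ j, k = j + 1 := ⟨k - 1, by omega⟩
  have h2 : (X * (X * derivative (derivative P))).coeff (k + 1) = 0 := by
    rw [coeff_X_mul]
    cases k with
    | zero => simp
    | succ k => simp [coeff_X_mul, coeff_derivative, h (k + 1 + 1) hk]
  have h3 : (derivative P * (C ((2 : ℂ) • lowerShift N) - X * C (matT11 N))).coeff (k + 1) = 0 := by
    rw [mul_sub, ← mul_assoc, ← X_mul, mul_assoc, coeff_sub, coeff_mul_C, coeff_X_mul, coeff_mul_C,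
      coeff_derivative, coeff_derivative, h _ hk, h _ (by omega)]
    simp
  rw [xAct, coeff_add, coeff_add, coeff_sub, h2, h3, coeff_mul_C, h _ hk, coeff_derivative,
    coeff_derivative, h _ (by omega)]
  simp

/-- Only `-x² P''`, `-x P' T₁¹` and `P T₀` reach degree `n`; together they give `-n(n-1) - n T₁¹ +
T₀`. -/
theorem coeff_xAct_top {P : (Mat N)[X]} {n : ℕ} (h : ∀ k, n < k → P.coeff k = 0)
    (h1 : P.coeff n = 1) :
    (xAct P).coeff n = eigD N n - (N : ℂ) • eigE N n := by
  have h2 : (X * (X * derivative (derivative P))).coeff n = ((n : ℂ) * (n - 1)) • (1 : Mat N) := by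
    cases n with
    | zero => simp
    | succ n =>
      rw [coeff_X_mul]
      cases n with
      | zero => simp
      | succ n =>
        rw [coeff_X_mul, coeff_derivative, coeff_derivative, h1]
        have e (k : ℕ) : (k : Mat N) = (k : ℂ) • 1 := by
          rw [Nat.cast_smul_eq_nsmul, nsmul_one]
        rw [← Nat.cast_succ, ← Nat.cast_succ, e, e, one_mul, smul_mul_smul_comm, mul_one]
        congr 1
        push_cast
        ring
  have h3 : (derivative P * (C ((2 : ℂ) • lowerShift N) - X * C (matT11 N))).coeff n =
      -((n : ℂ) • matT11 N) := by
    rw [mul_sub, ← mul_assoc, ← X_mul, mul_assoc, coeff_sub, coeff_mul_C,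
      coeff_derivative, h _ n.lt_succ_self]
    cases n with
    | zero => simp
    | succ n =>
      rw [coeff_X_mul, coeff_mul_C, coeff_derivative, h1]
      simp only [zero_mul, zero_sub, one_mul, ← Nat.cast_succ]
      rw [← nsmul_eq_mul, Nat.cast_smul_eq_nsmul]
  rw [xAct, coeff_add, coeff_add, coeff_sub, h2, h3, coeff_mul_C, h1, coeff_derivative,
    coeff_derivative, h _ (by omega)]
  ext i j
  have hN : (N : ℂ) = 0 → (i : ℕ) = 0 := fun h => by
    have : N = 0 := by exact_mod_cast h
    omega
  by_cases hij : i = j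
  · subst hij
    simp only [zero_mul, zero_sub, matT11, matT0, eigD, eigE, diag, Matrix.add_apply,
      Matrix.neg_apply, Matrix.sub_apply, Matrix.smul_apply, diagonal_apply_eq, one_mul,
      one_apply_eq, smul_eq_mul]
    by_cases h0 : (N : ℂ) = 0
    · simp [h0, hN h0]; ring
    · field_simp; ring
  · simp [matT11, matT0, eigD, eigE, diag, hij]

end MVOP

/-! ### Symmetry of the operator and the eigenvalue equation. -/

namespace MVOP

open Polynomial

variable {N : ℕ}

/-- The derivative of the weight on `(-1, 1)`. -/
noncomputable def weightDeriv (N : ℕ) (x : ℝ) : Mat N := of fun i j => (weightFunDeriv N i j x : ℂ)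

/-- Half of `F₁ W - W F₁ᴴ`, where `F₁` is the coefficient of `d/dx`. -/
noncomputable def skewPart (N : ℕ) (x : ℝ) : Mat N := of fun i j => (weightSkew N i j x : ℂ)

theorem hasMatDerivAt_weight {x : ℝ} (hx : x ∈ Set.Ioo (-1 : ℝ) 1) :
    HasMatDerivAt (weight N) (weightDeriv N x) x := by
  intro i j
  simp only [weight_apply]
  exact (hasDerivAt_weightFun (by omega) (by omega) hx).ofReal_comp

theorem hasMatDerivAt_skewPart {x : ℝ} (hx : x ∈ Set.Ioo (-1 : ℝ) 1) :
    HasMatDerivAt (skewPart N) (matT0 N * weight N x - weight N x * matT0 N) x := by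
  intro i j
  refine (hasDerivAt_weightSkew (N := N) (n := i) (m := j)
    (by omega) (by omega) hx).ofReal_comp.congr_deriv ?_
  simp only [matT0, diag, Matrix.sub_apply, diagonal_mul, mul_diagonal, weight_apply]
  push_cast
  ring

theorem firstCoeff_mul_weight {x : ℝ} (hx : x ∈ Set.Ioo (-1 : ℝ) 1) :
    firstCoeff N x * weight N x =
      skewPart N x + (1 - x ^ 2 : ℂ) • weightDeriv N x - (2 * x : ℂ) • weight N x := by
  have hp : (1 - x ^ 2 : ℂ) ≠ 0 := by
    have : (1 - x ^ 2 : ℝ) ≠ 0 := by nlinarith [hx.1, hx.2]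
    exact_mod_cast this
  ext i j
  rw [firstCoeff, sub_mul, smul_mul_assoc, smul_mul_assoc, Matrix.sub_apply, Matrix.smul_apply,
    lowerShift_mul_apply _ (fun k => (weightFun N k j x : ℂ)) j (fun k => weight_apply N x k j)]
  simp only [matT11, diag, Matrix.smul_apply, diagonal_mul, smul_eq_mul, Matrix.add_apply,
    Matrix.sub_apply, skewPart, weightDeriv, of_apply, weight_apply, weightFunDeriv, weightSkew]
  push_cast
  rw [mul_div_cancel₀ _ hp]
  ring

/-- The adjoint of the preceding relation: `W` and `W'` are real symmetric, while `K` is real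
antisymmetric. -/
theorem weight_mul_conjTranspose_firstCoeff {x : ℝ} (hx : x ∈ Set.Ioo (-1 : ℝ) 1) :
    weight N x * (firstCoeff N x)ᴴ =
      -skewPart N x + (1 - x ^ 2 : ℂ) • weightDeriv N x - (2 * x : ℂ) • weight N x := by
  have h := congrArg conjTranspose (firstCoeff_mul_weight (N := N) hx)
  rw [conjTranspose_mul, conjTranspose_weight] at h
  rw [h]
  ext i j
  simp only [Matrix.add_apply, Matrix.sub_apply, Matrix.neg_apply, Matrix.smul_apply,
    conjTranspose_apply, skewPart, weightDeriv, of_apply, weight_apply, weightFunDeriv, weightSkew,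
    smul_eq_mul, weightFun_comm N (j : ℕ) i, weightFun_comm N ((j : ℕ) - 1) i,
    weightFun_comm N (j : ℕ) ((i : ℕ) - 1), Complex.star_def, map_sub, map_add, map_mul,
    Complex.conj_ofReal]
  simp only [map_pow, map_one, map_ofNat, Complex.conj_ofReal]
  push_cast
  ring

theorem conjTranspose_matT0 : (matT0 N)ᴴ = matT0 N := by
  rw [matT0, diag, diagonal_conjTranspose]
  congr 1
  funext i
  simp

theorem continuous_skewPart : Continuous (skewPart N) :=
  continuous_matrix fun i j => by
    have h1 := continuous_weightFun N i j
    have h2 := continuous_weightFun N (i - 1) j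
    have h3 := continuous_weightFun N i (j - 1)
    simp only [skewPart, of_apply, weightSkew]
    fun_prop

/-- The boundary term in the symmetry relation of the second order operator. -/
noncomputable def boundaryTerm (P Q : (Mat N)[X]) (x : ℝ) : Mat N :=
  (1 - x ^ 2 : ℂ) • (polyVal (derivative P) x * weight N x * (polyVal Q x)ᴴ -
    polyVal P x * weight N x * (polyVal (derivative Q) x)ᴴ) +
  polyVal P x * skewPart N x * (polyVal Q x)ᴴ

theorem continuous_boundaryTerm (P Q : (Mat N)[X]) : Continuous (boundaryTerm P Q) := by
  unfold boundaryTerm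
  have h1 := continuous_integrand (derivative P) Q
  have h2 := continuous_integrand P (derivative Q)
  have h3 := ((continuous_polyVal P).matrix_mul continuous_skewPart).matrix_mul
    (continuous_polyVal Q).matrix_conjTranspose
  have h4 : Continuous fun x : ℝ => (1 - x ^ 2 : ℂ) := by fun_prop
  exact (h4.smul (h1.sub h2)).add h3

theorem boundaryTerm_eq_zero (P Q : (Mat N)[X]) {x : ℝ} (hx : x ^ 2 = 1) :
    boundaryTerm P Q x = 0 := by
  have h1 : skewPart N x = 0 := by
    ext i j
    simp [skewPart, weightSkew, weightFun_eq_zero _ _ _ hx]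
  have h2 : (1 - x ^ 2 : ℂ) = 0 := by
    rw [sub_eq_zero]; exact_mod_cast hx.symm
  rw [boundaryTerm, h1, h2]
  simp

theorem hasMatDerivAt_boundaryTerm (P Q : (Mat N)[X]) {x : ℝ} (hx : x ∈ Set.Ioo (-1 : ℝ) 1) :
    HasMatDerivAt (boundaryTerm P Q)
      (polyVal (xAct P) x * weight N x * (polyVal Q x)ᴴ -
        polyVal P x * weight N x * (polyVal (xAct Q) x)ᴴ) x := by
  have hf : HasDerivAt (fun y : ℝ => (1 - y ^ 2 : ℂ)) (-(2 * x)) x := by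
    have h : HasDerivAt (fun y : ℝ => (y : ℂ)) 1 x := (hasDerivAt_id x).ofReal_comp
    refine ((h.fun_pow 2).const_sub 1).congr_deriv ?_
    push_cast; ring
  have hP := hasMatDerivAt_polyVal P x
  have hP' := hasMatDerivAt_polyVal (derivative P) x
  have hQ := (hasMatDerivAt_polyVal Q x).conjTranspose
  have hQ' := (hasMatDerivAt_polyVal (derivative Q) x).conjTranspose
  have hW := hasMatDerivAt_weight (N := N) hx
  have h := (HasMatDerivAt.smul hf (((hP'.mul hW).mul hQ).sub ((hP.mul hW).mul hQ'))).add
    ((hP.mul (hasMatDerivAt_skewPart hx)).mul hQ)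
  have hs : star (1 - x ^ 2 : ℂ) = 1 - x ^ 2 := by simp
  have e1 (A : Mat N) := congrArg (· * A) (firstCoeff_mul_weight (N := N) hx)
  have e2 (A : Mat N) := congrArg (· * A) (weight_mul_conjTranspose_firstCoeff (N := N) hx)
  simp only [mul_assoc, add_mul, sub_mul, smul_mul_assoc, neg_mul] at e1 e2
  refine h.congr_deriv ?_
  simp only [polyVal_xAct, conjTranspose_add, conjTranspose_mul, conjTranspose_smul,
    conjTranspose_matT0, hs, mul_add, add_mul, mul_sub, sub_mul, smul_mul_assoc, mul_smul_comm,
    mul_assoc, e1, e2, mul_neg]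
  module

theorem matInner_xAct (P Q : (Mat N)[X]) : matInner (xAct P) Q = matInner P (xAct Q) := by
  ext i j
  simp only [matInner, of_apply]
  rw [← sub_eq_zero, ← intervalIntegral.integral_sub (intervalIntegrable_integrand _ _ i j)
    (intervalIntegrable_integrand _ _ i j)]
  -- The square root makes `W'` singular at `±1`, so differentiability is used only inside the
  -- interval. The derivative of the boundary term no longer contains `W'` and is continuous.
  refine (intervalIntegral.integral_eq_sub_of_hasDerivAt_of_le (by norm_num)
    ((continuous_boundaryTerm P Q).matrix_elem i j).continuousOn
    (fun x hx => hasMatDerivAt_boundaryTerm P Q hx i j)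
    ((intervalIntegrable_integrand _ _ i j).sub (intervalIntegrable_integrand _ _ i j))).trans ?_
  rw [boundaryTerm_eq_zero P Q (by norm_num), boundaryTerm_eq_zero P Q (by norm_num), sub_self]

theorem xAct_eq {P : ℕ → (Mat N)[X]} (hP : IsMonicOrthogonal N P) (n : ℕ) :
    xAct (P n) = C (eigD N n - (N : ℂ) • eigE N n) * P n := by
  have low (n k : ℕ) (hk : n < k) : (P n).coeff k = 0 :=
    coeff_eq_zero_of_natDegree_lt (by rwa [hP.natDegree_eq])
  rw [← sub_eq_zero]
  refine eq_zero_of_matInner hP n _ (fun k hk => ?_) fun m hm => ?_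
  · rw [coeff_sub, coeff_C_mul]
    rcases hk.eq_or_lt with rfl | hlt
    · rw [coeff_xAct_top (low n) (hP.monic n), hP.monic, mul_one, sub_self]
    · rw [coeff_xAct_of_lt (low n) hlt, low n k hlt, mul_zero, sub_zero]
  -- By symmetry the operator moves onto `P m`, where it yields degree at most `m < n`, orthogonal
  -- to `P n`.
  · rw [matInner_sub_left, matInner_C_mul_left, hP.orthogonal n m hm.ne', mul_zero, sub_zero,
      matInner_xAct, ← conjTranspose_matInner,
      matInner_eq_zero_of_coeff hP (m + 1) _ (fun k hk => coeff_xAct_of_lt (low m) hk) n hm,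
      conjTranspose_zero]

theorem hasMatDerivAt_polyVal_comp (P : (Mat N)[X]) (u : ℝ) :
    HasMatDerivAt (fun v => polyVal P (1 - 2 * v)) ((-2 : ℂ) • polyVal (derivative P) (1 - 2 * u))
      u := by
  intro i j
  have h : HasDerivAt (fun v : ℝ => 1 - 2 * v) (-2) u := by
    simpa using ((hasDerivAt_id u).const_mul 2).const_sub 1
  refine ((hasMatDerivAt_polyVal P (1 - 2 * u) i j).scomp u h).congr_deriv ?_
  simp

/-- Under `x = 1 - 2u` one has `d/du = -2 d/dx` and `4u(1-u) = 1 - x²`. -/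
theorem act_rescaled (P : ℕ → (Mat N)[X]) (n : ℕ) (u : ℝ) :
    (opDα N (-(N : ℝ))).act (rescaled P n) u =
      (((-1 : ℂ) ^ n) * ((2 : ℂ) ^ n)⁻¹) • polyVal (xAct (P n)) (1 - 2 * u) := by
  have h1 (v : ℝ) : HasMatDerivAt (rescaled P n) _ v :=
    (hasMatDerivAt_polyVal_comp (P n) v).const_smul _
  have h2 := ((hasMatDerivAt_polyVal_comp (derivative (P n)) u).const_smul (-2)).const_smul
    (((-1 : ℂ) ^ n) * ((2 : ℂ) ^ n)⁻¹)
  rw [DiffOp.act_of_hasMatDerivAt _ (Filter.Eventually.of_forall h1) h2, opDα_F2, opDα_neg_F0,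
    opDα_neg_F1, polyVal_xAct, rescaled, firstCoeff]
  push_cast
  simp only [mul_sub, smul_mul_assoc, mul_smul_comm, mul_one]
  module

theorem c2At_rescaled (P : ℕ → (Mat N)[X]) (n : ℕ) (u : ℝ) : C2At (rescaled P n) u := by
  intro i j
  simp only [rescaled, polyVal, Matrix.smul_apply, Matrix.sum_apply, smul_eq_mul]
  have h : ContDiff ℝ 2 fun v : ℝ => ((1 - 2 * v : ℝ) : ℂ) :=
    Complex.ofRealCLM.contDiff.comp (contDiff_const.sub (contDiff_const.mul contDiff_id))
  exact (contDiff_const.mul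
    (ContDiff.sum fun k _ => (h.pow k).mul contDiff_const)).contDiffAt

theorem opDiag_act_rescaled {P : ℕ → (Mat N)[X]} (hP : IsMonicOrthogonal N P) (n : ℕ) (u : ℝ) :
    (opDiag N).act (fun v => rescaled P n v * matM N v) u =
      (eigD N n - (N : ℂ) • eigE N n) * (rescaled P n u * matM N u) := by
  rw [← isConjugate_opDα_neg u _ ((c2At_rescaled P n u).mul (c2At_matM u))]
  have e : (fun v => rescaled P n v * matM N v * (matM N v)⁻¹) = rescaled P n := by
    funext v
    rw [mul_assoc, matM_mul_inv, mul_one]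
  rw [e, act_rescaled, xAct_eq hP, polyVal_mul, polyVal_C, rescaled]
  simp only [smul_mul_assoc, mul_smul_comm, mul_assoc]

end MVOP

theorem proposition6p1 (N : ℕ) :
    -- `M(u)` is invertible for every `u`, and `M⁻¹ D_{-2ℓ} M` is the explicit diagonal operator
    (∀ u : ℝ, IsUnit (matM N u)) ∧
    (opDiag N).IsDiagonal ∧
    DiffOp.IsConjugate (matM N) (opDα N (-(N : ℝ))) (opDiag N) ∧
    -- the functions `R_n M` are eigenfunctions
    (∀ P : ℕ → Polynomial (Mat N), IsMonicOrthogonal N P → ∀ (n : ℕ) (u : ℝ),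
      (opDiag N).act (fun v => rescaled P n v * matM N v) u =
        (eigD N n - (N : ℂ) • eigE N n) * (rescaled P n u * matM N u)) ∧
    -- `α = -2ℓ` is the only value for which `M⁻¹ D_α M` is diagonal
    (1 ≤ N → ∀ α : ℝ,
      (∃ D' : DiffOp N, D'.IsDiagonal ∧ DiffOp.IsConjugate (matM N) (opDα N α) D') →
        α = -(N : ℝ)) := by
  exact ⟨isUnit_matM, isDiagonal_opDiag, isConjugate_opDα_neg,
    fun _ hP n u => opDiag_act_rescaled hP n u,
    fun hN _ ⟨_, hd, h⟩ => eq_neg_of_isConjugate hN hd h⟩
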